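/- Let $d,n\in\mathbb N$, let $X$ be a random vector in $\mathbb R^d$ with $\mathbb E\|X\|^2<\infty$, and let $X_1,\dots,X_n$ be $n$ independent copies of $X$. Put $$\Sigma=\mathbb E\bigl[(X-\mathbb E X)(X-\mathbb E X)^\top\bigr],\qquad \overline\Sigma=\frac1{2n^2}\sum_{i=1}^n\sum_{j=1}^n (X_i-X_j)(X_i-X_j)^\top .$$ If $\Sigma=U\,\mathrm{diag}(\lambda_1,\dots,\lambda_d)\,U^\top$ with $U$ orthogonal, write $\Sigma^{-1/2}=U\,\mathrm{diag}\bigl(\mathbf 1(\lambda_i>0)\,\lambda_i^{-1/2}\bigr)U^\top$. Let $\kappa>0$ and assume that $$\sup\Bigl\{\mathbb E\bigl(\langle\theta,X-\mathbb EX\rangle^4\bigr)\;:\;\theta\in\mathbb R^d,\ \mathbb E\bigl(\langle\theta,X-\mathbb EX\rangle^2\bigr)\le 1\Bigr\}\le\kappa .$$ Let $\epsilon>0$, write $L=\log(\epsilon^{-1})+0.73\,(d+1)$, and assume that $$n>\Bigl[20(\kappa^{1/2}+1)\sqrt{d+1}+\Bigl(\frac52+\frac1{2(\kappa+2\kappa^{1/2})}\Bigr)\sqrt{2(\kappa+2\kappa^{1/2})\,L}\Bigr]^2$$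 (when $\epsilon$ is so large that $L<0$, in which case the probability statement below is empty, the square root of a negative number is read as $0$). Define $$\mu=\sqrt{\frac{2(\kappa+2\kappa^{1/2})}{n}\,L}+6.81\,(\kappa^{1/2}+1)\sqrt{\frac{2(d+1)}n},\qquad \widehat\delta=\frac{\mu}{1-2\mu},$$ $$R=\max_{1\le i\le n}\bigl(\|\Sigma^{-1/2}(X_i-\mathbb EX)\|^2+1\bigr)^{1/2},\qquad \gamma_-=\frac{2L}{3(\kappa+2\kappa^{1/2})\,n},\qquad \gamma_+=\gamma_-\,R^4(1+\widehat\delta)^2 .$$ Then, with probability at least $1-2\epsilon$ (that is, on some measurable event of at least this probability), for all $\theta\in\mathbb R^d$, $$-\frac{\widehat\delta+\gamma_-}{1+\widehat\delta}\;\le\;\frac{\theta^\top\overline\Sigma\,\theta}{\theta^\top\Sigma\,\theta}-1\;\le\;\frac{\widehat\delta+\gamma_+}{(1-\widehat\delta)_+\,(1-\gamma_+)_+},$$ where $(z)_+=\max\{z,0\}$, and quotients with zero denominator are read as $0/0=1$ and $z/0=+\infty$ for $z>0$. Moreover, there is a numerical constant $C>0$ (independent of all parameters) such that, whenever the above condition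 on $n$ holds with $d\ge1$, $\kappa\ge1$ (both automatic when $\Sigma\neq0$) and $0<\epsilon\le1$, $$\widehat\delta\le C\sqrt{\frac{\kappa\,[d+\log(\epsilon^{-1})]}{n}}\qquad\text{and}\qquad\frac{\widehat\delta+\gamma_-}{1+\widehat\delta}\le C\,\widehat\delta .$$ -/

import Mathlib

open MeasureTheory ProbabilityTheory

noncomputable section

namespace EmpCov

/-- The space `ℝ^d` with its Euclidean norm and inner product. -/
abbrev Vec (d : ℕ) : Type := EuclideanSpace ℝ (Fin d)

/-- The covariance matrix `Σ = E[(X - E X)(X - E X)ᵀ]`. -/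
def covMatrix {d : ℕ} {Ω : Type*} [MeasurableSpace Ω] (P : Measure Ω) (X : Ω → Vec d) :
    Matrix (Fin d) (Fin d) ℝ :=
  Matrix.of fun j k => ∫ ω, (X ω - ∫ ω', X ω' ∂P) j * (X ω - ∫ ω', X ω' ∂P) k ∂P

theorem covMatrix_isHermitian {d : ℕ} {Ω : Type*} [MeasurableSpace Ω] (P : Measure Ω)
    (X : Ω → Vec d) : (covMatrix P X).IsHermitian := by
  ext j k
  simp [covMatrix, Matrix.conjTranspose_apply, mul_comm]

/-- The (generalized) inverse square root `U diag(1(λᵢ > 0) λᵢ^{-1/2}) Uᵀ` of a symmetric matrix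
`A = U diag(λᵢ) Uᵀ`. -/
def invSqrt {d : ℕ} {A : Matrix (Fin d) (Fin d) ℝ} (hA : A.IsHermitian) :
    Matrix (Fin d) (Fin d) ℝ :=
  (hA.eigenvectorUnitary : Matrix (Fin d) (Fin d) ℝ) *
    Matrix.diagonal (fun i => if 0 < hA.eigenvalues i then 1 / √(hA.eigenvalues i) else 0) *
    (hA.eigenvectorUnitary : Matrix (Fin d) (Fin d) ℝ).transpose

/-- The empirical covariance `(2 n²)⁻¹ ∑ᵢ ∑ⱼ (xᵢ - xⱼ)(xᵢ - xⱼ)ᵀ`. -/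
def empCovMatrix {d n : ℕ} (x : Fin n → Vec d) : Matrix (Fin d) (Fin d) ℝ :=
  (1 / (2 * (n : ℝ) ^ 2)) •
    ∑ i, ∑ j, Matrix.vecMulVec (x i - x j).ofLp (x i - x j).ofLp

/-- The quadratic form `θᵀ A θ`. -/
def quadForm {d : ℕ} (A : Matrix (Fin d) (Fin d) ℝ) (θ : Vec d) : ℝ :=
  θ.ofLp ⬝ᵥ A.mulVec θ.ofLp

/-- `sup {E⟨θ, X - E X⟩⁴ : E⟨θ, X - E X⟩² ≤ 1}`, with values in `[0, ∞]`. -/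
def kurtosis {d : ℕ} {Ω : Type*} [MeasurableSpace Ω] (P : Measure Ω) (X : Ω → Vec d) :
    ENNReal :=
  ⨆ θ ∈ {θ : Vec d | ∫ ω, (inner ℝ θ (X ω - ∫ ω', X ω' ∂P)) ^ 2 ∂P ≤ 1},
    ∫⁻ ω, ENNReal.ofReal ((inner ℝ θ (X ω - ∫ ω', X ω' ∂P)) ^ 4) ∂P

/-- `R = maxᵢ (‖Σ^{-1/2}(xᵢ - E X)‖² + 1)^{1/2}`, for the sample `x₁, …, xₙ`. -/
def maxNorm {d n : ℕ} {Ω : Type*} [MeasurableSpace Ω] (P : Measure Ω) (X : Ω → Vec d)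
    (x : Fin n → Vec d) : ℝ :=
  ⨆ i, √(‖WithLp.toLp 2
    ((invSqrt (covMatrix_isHermitian P X)).mulVec (x i - ∫ ω, X ω ∂P).ofLp)‖ ^ 2 + 1)

/-- `log(ε⁻¹) + 0.73 (d + 1)`. -/
def level (d : ℕ) (ε : ℝ) : ℝ := Real.log ε⁻¹ + 0.73 * ((d : ℝ) + 1)

/-- The lower bound required of the sample size. -/
def sampleBound (d : ℕ) (κ ε : ℝ) : ℝ :=
  (20 * (√κ + 1) * √((d : ℝ) + 1) +
    (5 / 2 + 1 / (2 * (κ + 2 * √κ))) * √(2 * (κ + 2 * √κ) * level d ε)) ^ 2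

def mu (d n : ℕ) (κ ε : ℝ) : ℝ :=
  √(2 * (κ + 2 * √κ) / n * level d ε) + 6.81 * (√κ + 1) * √(2 * ((d : ℝ) + 1) / n)

def deltaHat (d n : ℕ) (κ ε : ℝ) : ℝ := mu d n κ ε / (1 - 2 * mu d n κ ε)

def gammaMinus (d n : ℕ) (κ ε : ℝ) : ℝ := 2 * level d ε / (3 * (κ + 2 * √κ) * n)

def gammaPlus (d n : ℕ) (κ ε R : ℝ) : ℝ :=
  gammaMinus d n κ ε * R ^ 4 * (1 + deltaHat d n κ ε) ^ 2

/-- The quotient `a / b` of nonnegative numbers with `0 / 0 = 1` and `a / 0 = +∞` for `a > 0`. -/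
def ratio (a b : ℝ) : EReal :=
  if b = 0 then (if a = 0 then 1 else ⊤) else ((a / b : ℝ) : EReal)

end EmpCov

end

/-! The proof is PAC-Bayesian, with Gaussian weights on the directions. Whiten the sample and add a
constant coordinate: `V = (1, Σ^{-1/2}(X - EX))` in `ℝ^(d+1)`. Every affine function `c + ⟨θ, X -
EX⟩` is almost surely a linear functional of `V`, so one uniform bound for `∑ ⟨τ, V_i⟩²` also covers
the centering by the empirical mean. By `whiten_moments`, `V` has second moments at most `‖τ‖²`
(with equality in the directions `whitenDual`) and fourth moments at most `(κ + 2√κ + 1)‖τ‖⁴`.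

Uniformity in the direction comes from `pacBayes_quadratic`. The exponential process `exp(∑
(s(⟨x,Y_i⟩² - ‖Y_i‖² - 1) - q(x)))` has mean at most `1` for each `x`. Integrating over `x ~ N(0,
I)` and applying Markov's inequality gives one event; on it, changing the Gaussian to `N(τ, I)`
costs only the entropy `‖τ‖²/2`, for all `τ` at once. Taking `Y = √(w(V)/β) V` and `τ = √β θ` makes
this cost `β/2` and the smoothing error of order `‖V‖²/β`.

Only four moments are available, so the Laplace transforms must be bounded by quadratic polynomials.
For the lower bound `exp(-x) ≤ 1 - x + x²/2` suffices, and the weight merely keeps `Y` bounded. For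
the upper bound the weight `(1 - u²/3)₊` at `u = l‖V‖²` gives `exp(v w) ≤ 1 + v + v²/2` for `0 ≤ v ≤
u` (`exp_sub_cube_le`); on the sample this weight is at least `1 - γ₊`, which is where `R` enters.
The scales `l` and `β` are fixed in `exists_tuning`, and `gram_upper` and `gram_lower` convert the
deviations into `δ̂`, `γ₋` and `γ₊`.

The degenerate cases are separate: null directions of `Σ` are null for the sample almost surely, `κ
< 1` forces `Σ = 0`, and for `ε > 1/2` nothing is claimed. -/

namespace EmpCov

/-! ### Gaussian measures: change of mean, and the entropy inequality -/

section Gaussian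

variable {E : Type*} [NormedAddCommGroup E] [InnerProductSpace ℝ E] [FiniteDimensional ℝ E]
  [MeasurableSpace E] [BorelSpace E]

theorem integrable_exp_neg_sq_norm_div_two :
    Integrable (fun x : E => Real.exp (-‖x‖ ^ 2 / 2)) := by
  have h := (GaussianFourier.integrable_cexp_neg_mul_sq_norm_add (V := E) (b := 1 / 2)
    (by norm_num) 0 0).re
  refine h.congr (Filter.Eventually.of_forall fun x => ?_)
  simp only [zero_mul, add_zero]
  rw [show (-(1 / 2 : ℂ) * (‖x‖ : ℂ) ^ 2) = ((-‖x‖ ^ 2 / 2 : ℝ) : ℂ) by push_cast; ring]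
  exact Complex.exp_ofReal_re _

/-- The density of the standard Gaussian measure with respect to the Lebesgue measure. -/
theorem stdGaussian_eq_withDensity :
    stdGaussian E = volume.withDensity fun x : E => ENNReal.ofReal
      ((2 * Real.pi) ^ (-(Module.finrank ℝ E : ℝ) / 2) * Real.exp (-‖x‖ ^ 2 / 2)) := by
  have hint := (integrable_exp_neg_sq_norm_div_two (E := E)).const_mul
    ((2 * Real.pi) ^ (-(Module.finrank ℝ E : ℝ) / 2))
  have : IsFiniteMeasure (volume.withDensity fun x : E => ENNReal.ofReal
      ((2 * Real.pi) ^ (-(Module.finrank ℝ E : ℝ) / 2) * Real.exp (-‖x‖ ^ 2 / 2))) :=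
    isFiniteMeasure_withDensity_ofReal hint.2
  apply Measure.ext_of_charFun
  ext t
  rw [charFun_stdGaussian, charFun_apply, integral_withDensity_eq_integral_toReal_smul
    (by fun_prop) (by simp)]
  have h := GaussianFourier.integral_cexp_neg_mul_sq_norm_add (V := E) (b := 1 / 2)
    (by norm_num) Complex.I t
  have hpi : (0 : ℝ) < 2 * Real.pi := by positivity
  calc Complex.exp (-(‖t‖ : ℂ) ^ 2 / 2)
      = (((2 * Real.pi) ^ (-(Module.finrank ℝ E : ℝ) / 2) : ℝ) : ℂ) *
        ∫ v : E, Complex.exp (-(1 / 2) * (‖v‖ : ℂ) ^ 2 + Complex.I * (inner ℝ t v : ℝ)) := by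
        rw [h, ← mul_assoc]
        have h1 : ((Real.pi : ℂ) / (1 / 2)) ^ ((Module.finrank ℝ E : ℂ) / 2)
            = (((2 * Real.pi) ^ ((Module.finrank ℝ E : ℝ) / 2) : ℝ) : ℂ) := by
          rw [Complex.ofReal_cpow hpi.le]
          push_cast
          congr 1
          ring
        rw [h1, ← Complex.ofReal_mul, ← Real.rpow_add hpi,
          show -(Module.finrank ℝ E : ℝ) / 2 + (Module.finrank ℝ E : ℝ) / 2 = 0 by ring,
          Real.rpow_zero, Complex.ofReal_one, one_mul, Complex.I_sq]
        congr 1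
        ring
    _ = _ := by
        rw [← integral_const_mul]
        refine integral_congr_ae (Filter.Eventually.of_forall fun x => ?_)
        simp only
        rw [ENNReal.toReal_ofReal (by positivity), Complex.real_smul, Complex.ofReal_mul, mul_assoc,
          Complex.ofReal_exp, ← Complex.exp_add, real_inner_comm]
        congr 2
        push_cast
        ring

/-- The Cameron–Martin formula: translate Lebesgue measure and expand `‖τ + x‖²` in the density. -/
theorem lintegral_stdGaussian_eq_lintegral_shift (τ : E) {F : E → ENNReal} (hF : Measurable F) :
    ∫⁻ x, F x ∂stdGaussian E =
      ∫⁻ x, F (τ + x) * ENNReal.ofReal (Real.exp (-inner ℝ τ x - ‖τ‖ ^ 2 / 2))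
        ∂stdGaussian E := by
  rw [stdGaussian_eq_withDensity, lintegral_withDensity_eq_lintegral_mul _ (by fun_prop) hF,
    lintegral_withDensity_eq_lintegral_mul _ (by fun_prop) (by fun_prop),
    ← lintegral_add_left_eq_self _ τ]
  refine lintegral_congr fun x => ?_
  simp only [Pi.mul_apply]
  rw [mul_comm (F _), ← mul_assoc, ← ENNReal.ofReal_mul (by positivity), mul_assoc,
    ← Real.exp_add, norm_add_sq_real]
  congr 4
  ring

/-- Jensen's inequality for the exponential. -/
theorem ofReal_exp_integral_le {Ω : Type*} [MeasurableSpace Ω] {μ : Measure Ω}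
    [IsProbabilityMeasure μ] {f : Ω → ℝ} (hf : Integrable f μ) :
    ENNReal.ofReal (Real.exp (∫ x, f x ∂μ)) ≤ ∫⁻ x, ENNReal.ofReal (Real.exp (f x)) ∂μ := by
  set c := ∫ x, f x ∂μ
  -- Tangent line at the mean. Lower integrals are used throughout because `exp ∘ f` need not be
  -- integrable.
  have h1 : 1 ≤ ∫⁻ x, ENNReal.ofReal (Real.exp (f x - c)) ∂μ := by
    calc (1 : ENNReal) = ENNReal.ofReal (∫ x, (f x - c + 1) ∂μ) := by
          rw [integral_add (f := fun x => f x - c) (hf.sub (integrable_const c))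
            (integrable_const 1), integral_sub hf (integrable_const c)]
          simp [c]
      _ ≤ ∫⁻ x, ENNReal.ofReal (f x - c + 1) ∂μ := by
          rw [integral_eq_lintegral_pos_part_sub_lintegral_neg_part
            (f := fun x => f x - c + 1) ((hf.sub (integrable_const c)).add (integrable_const 1))]
          refine ENNReal.ofReal_le_of_le_toReal ?_
          exact sub_le_self _ ENNReal.toReal_nonneg
      _ ≤ _ := lintegral_mono fun x => ENNReal.ofReal_le_ofReal (Real.add_one_le_exp _)
  calc ENNReal.ofReal (Real.exp c) = ENNReal.ofReal (Real.exp c) * 1 := (mul_one _).symm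
    _ ≤ ENNReal.ofReal (Real.exp c) * ∫⁻ x, ENNReal.ofReal (Real.exp (f x - c)) ∂μ := by gcongr
    _ = _ := by
        rw [← lintegral_const_mul' _ _ ENNReal.ofReal_ne_top]
        refine lintegral_congr fun x => ?_
        rw [← ENNReal.ofReal_mul (by positivity), ← Real.exp_add]
        congr 2
        ring

theorem map_inner_stdGaussian (y : E) :
    (stdGaussian E).map (fun x => inner ℝ y x) = gaussianReal 0 (‖y‖₊ ^ 2) := by
  have h := IsGaussian.map_eq_gaussianReal (μ := stdGaussian E) (innerSL ℝ y)
  rw [integral_strongDual_stdGaussian, variance_dual_stdGaussian, innerSL_apply_norm] at h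
  rw [Real.toNNReal_pow (norm_nonneg _), norm_toNNReal] at h
  exact h

/-- The Donsker-Varadhan inequality for Gaussian shifts. -/
theorem integral_shift_le {τ : E} {f : E → ℝ} (hf : Measurable f) {b : ℝ}
    (hint : Integrable (fun x => f (τ + x)) (stdGaussian E))
    (hb : ∫⁻ x, ENNReal.ofReal (Real.exp (f x)) ∂stdGaussian E ≤ ENNReal.ofReal (Real.exp b)) :
    ∫ x, f (τ + x) ∂stdGaussian E ≤ ‖τ‖ ^ 2 / 2 + b := by
  have hi : Integrable (fun x => inner ℝ τ x) (stdGaussian E) :=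
    ((innerSL ℝ τ).integrable_comp IsGaussian.integrable_id)
  have h0 : ∫ x, inner ℝ τ x ∂stdGaussian E = 0 := integral_strongDual_stdGaussian (innerSL ℝ τ)
  -- Jensen applied to `f` minus the log-density of the shifted Gaussian; that log-density has mean
  -- `‖τ‖²/2`, the relative entropy.
  have hJ := ofReal_exp_integral_le (μ := stdGaussian E)
    (f := fun x => f (τ + x) - inner ℝ τ x - ‖τ‖ ^ 2 / 2)
    ((hint.sub hi).sub (integrable_const _))
  have e : ∫ x, (f (τ + x) - inner ℝ τ x - ‖τ‖ ^ 2 / 2) ∂stdGaussian E =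
      ∫ x, f (τ + x) ∂stdGaussian E - ‖τ‖ ^ 2 / 2 := by
    rw [integral_sub (f := fun x => f (τ + x) - inner ℝ τ x) (hint.sub hi) (integrable_const _),
      integral_sub hint hi, h0]
    simp
  rw [lintegral_stdGaussian_eq_lintegral_shift τ (by fun_prop)] at hb
  have h2 : ∫⁻ x, ENNReal.ofReal (Real.exp (f (τ + x) - inner ℝ τ x - ‖τ‖ ^ 2 / 2))
      ∂stdGaussian E ≤ ENNReal.ofReal (Real.exp b) := by
    refine le_trans (le_of_eq (lintegral_congr fun x => ?_)) hb
    rw [← ENNReal.ofReal_mul (by positivity), ← Real.exp_add]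
    congr 2
    ring
  have h3 := hJ.trans h2
  rw [ENNReal.ofReal_le_ofReal_iff (by positivity), Real.exp_le_exp, e] at h3
  linarith

end Gaussian

/-- The Gaussian integral of `exp (s x²)`. -/
theorem integral_exp_sq_gaussianReal (m s : ℝ) (v : NNReal) (h : 2 * s * v < 1) :
    Integrable (fun x => Real.exp (s * (m + x) ^ 2)) (gaussianReal 0 v) ∧
    ∫ x, Real.exp (s * (m + x) ^ 2) ∂gaussianReal 0 v =
      (√(1 - 2 * s * v))⁻¹ * Real.exp (s * m ^ 2 / (1 - 2 * s * v)) := by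
  -- Zero variance is the Dirac mass, which has no density; it occurs below for `y = 0`.
  by_cases hv : v = 0
  · subst hv
    simp [integrable_dirac]
  have hv0 : (0 : ℝ) < v := by positivity
  set r : ℝ := 1 - 2 * s * v with hr
  have hr0 : 0 < r := by linarith
  set b : ℝ := r / (2 * v) with hbdef
  have hb : 0 < b := by positivity
  -- Completing the square; `2sv < 1` keeps the leading coefficient negative.
  have key : ∀ x : ℝ, gaussianPDFReal 0 v x * Real.exp (s * (m + x) ^ 2) =
      ((√(2 * Real.pi * v))⁻¹ * Real.exp (s * m ^ 2 / r)) *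
        Real.exp (-b * (x - 2 * s * m * v / r) ^ 2) := by
    intro x
    rw [gaussianPDFReal_def]
    simp only
    rw [mul_assoc _ (Real.exp _), mul_assoc _ (Real.exp _), ← Real.exp_add, ← Real.exp_add]
    congr 2
    rw [hbdef]
    have hs : s = (1 - r) / (2 * v) := by rw [hr]; field_simp; ring
    rw [hs]
    field_simp
    ring
  have hi0 : Integrable (fun x : ℝ => Real.exp (-b * (x - 2 * s * m * v / r) ^ 2)) :=
    (integrable_exp_neg_mul_sq hb).comp_sub_right _
  refine ⟨?_, ?_⟩
  · rw [gaussianReal_of_var_ne_zero _ hv,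
      integrable_withDensity_iff_integrable_smul' (measurable_gaussianPDF _ _)
        (Filter.Eventually.of_forall fun x => gaussianPDF_lt_top)]
    simp only [toReal_gaussianPDF, smul_eq_mul, key]
    exact hi0.const_mul _
  · rw [integral_gaussianReal_eq_integral_smul hv]
    simp only [smul_eq_mul, key]
    rw [integral_const_mul, integral_sub_right_eq_self (fun x => Real.exp (-b * x ^ 2)),
      integral_gaussian]
    have : Real.pi / b = (2 * Real.pi * v) / r := by rw [hbdef]; field_simp
    rw [this, Real.sqrt_div (by positivity)]
    have h1 : √(2 * Real.pi * v) ≠ 0 := by positivity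
    field_simp

/-! ### The PAC-Bayesian inequality for quadratic forms -/

section PacBayes

variable {E : Type*} [NormedAddCommGroup E] [InnerProductSpace ℝ E] [FiniteDimensional ℝ E]
  [MeasurableSpace E] [BorelSpace E]

/-- The exponent `s (⟨x, y⟩² - ‖y‖² - 1)`. -/
noncomputable def quadExponent (s : ℝ) (x y : E) : ℝ := s * ((inner ℝ x y) ^ 2 - ‖y‖ ^ 2 - 1)

/-- The integral of `exp (quadExponent s x y)` when `x` is Gaussian with mean `τ` and identity
covariance. -/
noncomputable def quadLaplace (s : ℝ) (τ y : E) : ℝ :=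
  Real.exp (-s) * (Real.exp (-(s * ‖y‖ ^ 2)) * (√(1 - 2 * (s * ‖y‖ ^ 2)))⁻¹ *
    Real.exp (s * (inner ℝ τ y) ^ 2 / (1 - 2 * (s * ‖y‖ ^ 2))))

theorem measurable_quadExponent (s : ℝ) :
    Measurable fun p : E × E => quadExponent s p.1 p.2 := by
  unfold quadExponent
  exact (by fun_prop : Continuous fun p : E × E =>
    s * ((inner ℝ p.1 p.2 : ℝ) ^ 2 - ‖p.2‖ ^ 2 - 1)).measurable

theorem measurable_quadLaplace (s : ℝ) (τ : E) : Measurable (quadLaplace s τ) := by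
  unfold quadLaplace
  fun_prop

theorem integral_exp_quadExponent (s : ℝ) (τ y : E) (h : 2 * (s * ‖y‖ ^ 2) < 1) :
    Integrable (fun x => Real.exp (quadExponent s (τ + x) y)) (stdGaussian E) ∧
    ∫ x, Real.exp (quadExponent s (τ + x) y) ∂stdGaussian E = quadLaplace s τ y := by
  have hm : AEMeasurable (fun x : E => (inner ℝ y x : ℝ)) (stdGaussian E) := by fun_prop
  have hv : ((‖y‖₊ ^ 2 : NNReal) : ℝ) = ‖y‖ ^ 2 := by simp
  have hg := integral_exp_sq_gaussianReal (inner ℝ τ y) s (‖y‖₊ ^ 2) (by rw [hv]; linarith)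
  rw [← map_inner_stdGaussian, integrable_map_measure (by fun_prop) hm,
    integral_map hm (by fun_prop), hv] at hg
  have e : ∀ x : E, Real.exp (quadExponent s (τ + x) y) =
      (Real.exp (-s) * Real.exp (-(s * ‖y‖ ^ 2))) *
        Real.exp (s * ((inner ℝ τ y : ℝ) + inner ℝ y x) ^ 2) := by
    intro x
    rw [← Real.exp_add, ← Real.exp_add, quadExponent, inner_add_left, real_inner_comm y x]
    congr 1
    ring
  simp only [e]
  refine ⟨hg.1.const_mul _, ?_⟩
  rw [integral_const_mul, hg.2, quadLaplace]
  simp only [mul_assoc]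

/-- Under `N(τ, I)` the variance of `⟨x, y⟩` is `‖y‖²`; the term `-‖y‖²` in the exponent cancels it,
so Gaussian smoothing leaves the quadratic form unbiased. -/
theorem integral_quadExponent (s : ℝ) (τ y : E) :
    Integrable (fun x => quadExponent s (τ + x) y) (stdGaussian E) ∧
    ∫ x, quadExponent s (τ + x) y ∂stdGaussian E = s * ((inner ℝ τ y) ^ 2 - 1) := by
  have hL2 : MemLp (fun x : E => (inner ℝ y x : ℝ)) 2 (stdGaussian E) :=
    (innerSL ℝ y).comp_memLp' IsGaussian.memLp_two_id
  have h0 : ∫ x, (inner ℝ y x : ℝ) ∂stdGaussian E = 0 :=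
    integral_strongDual_stdGaussian (innerSL ℝ y)
  have h2 : ∫ x, (inner ℝ y x : ℝ) ^ 2 ∂stdGaussian E = ‖y‖ ^ 2 := by
    have h := variance_dual_stdGaussian (innerSL ℝ y)
    rw [innerSL_apply_norm, variance_of_integral_eq_zero
      (innerSL ℝ y).continuous.aemeasurable (integral_strongDual_stdGaussian _)] at h
    exact h
  have i1 : Integrable (fun x : E => (inner ℝ y x : ℝ)) (stdGaussian E) :=
    hL2.integrable (by norm_num)
  have i2 : Integrable (fun x : E => (inner ℝ y x : ℝ) ^ 2) (stdGaussian E) := hL2.integrable_sq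
  have e : ∀ x : E, quadExponent s (τ + x) y =
      s * (inner ℝ y x : ℝ) ^ 2 + (2 * s * inner ℝ τ y) * inner ℝ y x +
        s * ((inner ℝ τ y : ℝ) ^ 2 - ‖y‖ ^ 2 - 1) := by
    intro x
    rw [quadExponent, inner_add_left, real_inner_comm y x]
    ring
  simp only [e]
  have i3 := (i2.const_mul s).add (i1.const_mul (2 * s * inner ℝ τ y))
  refine ⟨i3.add (integrable_const _), ?_⟩
  rw [integral_add (f := fun x => s * (inner ℝ y x : ℝ) ^ 2 + (2 * s * inner ℝ τ y) * inner ℝ y x)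
    i3 (integrable_const _), integral_add (i2.const_mul s) (i1.const_mul _),
    integral_const_mul, integral_const_mul, h0, h2]
  simp
  ring

theorem integrable_exp_quadExponent {ρ : Measure E} [IsProbabilityMeasure ρ] {s B : ℝ}
    (hB : ∀ᵐ y ∂ρ, ‖y‖ ≤ B) (x : E) :
    Integrable (fun y => Real.exp (quadExponent s x y)) ρ := by
  refine Integrable.of_bound (C := Real.exp (|s| * (‖x‖ ^ 2 * B ^ 2 + B ^ 2 + 1)))
    ((measurable_quadExponent s).comp measurable_prodMk_left).exp.aestronglyMeasurable ?_
  filter_upwards [hB] with y hy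
  rw [Real.norm_eq_abs, Real.abs_exp, Real.exp_le_exp, quadExponent]
  have h1 : ‖y‖ ^ 2 ≤ B ^ 2 := by gcongr
  have h2 : (inner ℝ x y : ℝ) ^ 2 ≤ ‖x‖ ^ 2 * B ^ 2 := by
    calc (inner ℝ x y : ℝ) ^ 2 = |inner ℝ x y| ^ 2 := (sq_abs _).symm
      _ ≤ (‖x‖ * ‖y‖) ^ 2 := by gcongr; exact abs_real_inner_le_norm x y
      _ = ‖x‖ ^ 2 * ‖y‖ ^ 2 := by ring
      _ ≤ _ := by gcongr
  refine (le_abs_self _).trans ?_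
  rw [abs_mul]
  gcongr
  rw [abs_le]
  constructor <;> nlinarith [sq_nonneg (inner ℝ x y : ℝ), sq_nonneg ‖y‖]

theorem integrable_quadLaplace {ρ : Measure E} [IsProbabilityMeasure ρ] {s B : ℝ}
    (hB : ∀ᵐ y ∂ρ, ‖y‖ ≤ B) (hs : ∀ᵐ y ∂ρ, s * ‖y‖ ^ 2 ≤ 1 / 4) (τ : E) :
    Integrable (quadLaplace s τ) ρ := by
  refine Integrable.of_bound (C := Real.exp (-s) * (Real.exp (|s| * B ^ 2) * (√(1 / 2))⁻¹ *
    Real.exp (2 * (|s| * (‖τ‖ ^ 2 * B ^ 2)))))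
    (measurable_quadLaplace s τ).aestronglyMeasurable ?_
  filter_upwards [hB, hs] with y hy hy'
  have h1 : ‖y‖ ^ 2 ≤ B ^ 2 := by gcongr
  have h2 : (inner ℝ τ y : ℝ) ^ 2 ≤ ‖τ‖ ^ 2 * B ^ 2 := by
    calc (inner ℝ τ y : ℝ) ^ 2 = |inner ℝ τ y| ^ 2 := (sq_abs _).symm
      _ ≤ (‖τ‖ * ‖y‖) ^ 2 := by gcongr; exact abs_real_inner_le_norm τ y
      _ = ‖τ‖ ^ 2 * ‖y‖ ^ 2 := by ring
      _ ≤ _ := by gcongr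
  have h3 : (1 : ℝ) / 2 ≤ 1 - 2 * (s * ‖y‖ ^ 2) := by linarith
  rw [Real.norm_of_nonneg (by unfold quadLaplace; positivity), quadLaplace]
  gcongr
  · calc -(s * ‖y‖ ^ 2) ≤ |s * ‖y‖ ^ 2| := neg_le_abs _
      _ = |s| * ‖y‖ ^ 2 := by rw [abs_mul, abs_of_nonneg (sq_nonneg ‖y‖)]
      _ ≤ _ := by gcongr
  · calc s * (inner ℝ τ y : ℝ) ^ 2 / (1 - 2 * (s * ‖y‖ ^ 2))
        ≤ (|s| * (‖τ‖ ^ 2 * B ^ 2)) / (1 - 2 * (s * ‖y‖ ^ 2)) := by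
          gcongr
          · exact le_abs_self s
      _ ≤ (|s| * (‖τ‖ ^ 2 * B ^ 2)) / (1 / 2) := by gcongr
      _ = _ := by ring

/-- A PAC-Bayesian deviation bound, uniform in the direction, for quadratic forms of an
independent sample of bounded random vectors. -/
theorem pacBayes_quadratic {Ω : Type*} [MeasurableSpace Ω] {P : Measure Ω} [IsProbabilityMeasure P]
    {n : ℕ} {Y : Fin n → Ω → E} (hY : ∀ i, Measurable (Y i)) (hind : iIndepFun Y P)
    {ρ : Measure E} [IsProbabilityMeasure ρ] (hlaw : ∀ i, P.map (Y i) = ρ) {s B : ℝ}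
    (hB : ∀ᵐ y ∂ρ, ‖y‖ ≤ B) (hs : ∀ᵐ y ∂ρ, s * ‖y‖ ^ 2 ≤ 1 / 4) {ε : ℝ} (hε : 0 < ε) :
    ∃ A : Set Ω, MeasurableSet A ∧ P Aᶜ ≤ ENNReal.ofReal ε ∧ ∀ ω ∈ A, ∀ τ : E,
      ∑ i, s * ((inner ℝ τ (Y i ω)) ^ 2 - 1) ≤
        n * (∫ y, quadLaplace s τ y ∂ρ - 1) + (‖τ‖ ^ 2 / 2 + Real.log ε⁻¹) := by
  have hTm := measurable_quadExponent (E := E) s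
  have hT2 : ∀ x, Measurable fun y : E => quadExponent s x y := fun x =>
    hTm.comp measurable_prodMk_left
  -- `q` replaces the log-Laplace transform. Unlike the logarithm, it can be averaged over `x` by
  -- Fubini, which leads to the explicit Gaussian integral `quadLaplace`.
  set q : E → ℝ := fun x => ∫ y, Real.exp (quadExponent s x y) ∂ρ - 1 with hq
  have hqm : Measurable q := by
    have : StronglyMeasurable fun x => ∫ y, Real.exp (quadExponent s x y) ∂ρ :=
      hTm.exp.stronglyMeasurable.integral_prod_right
    exact this.measurable.sub_const 1
  have hqi : ∀ τ, Integrable (fun x => q (τ + x)) (stdGaussian E) ∧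
      ∫ x, q (τ + x) ∂stdGaussian E = ∫ y, quadLaplace s τ y ∂ρ - 1 := by
    intro τ
    have hpm : Measurable fun p : E × E => Real.exp (quadExponent s (τ + p.1) p.2) :=
      (hTm.comp ((measurable_fst.const_add τ).prodMk measurable_snd)).exp
    have hG : ∀ᵐ y ∂ρ, Integrable (fun x => Real.exp (quadExponent s (τ + x) y)) (stdGaussian E) ∧
        ∫ x, Real.exp (quadExponent s (τ + x) y) ∂stdGaussian E = quadLaplace s τ y := by
      filter_upwards [hs] with y hy
      exact integral_exp_quadExponent s τ y (by linarith)
    have hprod : Integrable (fun p : E × E => Real.exp (quadExponent s (τ + p.1) p.2))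
        ((stdGaussian E).prod ρ) := by
      rw [integrable_prod_iff' hpm.aestronglyMeasurable]
      refine ⟨hG.mono fun y hy => hy.1, (integrable_quadLaplace hB hs τ).congr ?_⟩
      filter_upwards [hG] with y hy
      simp only [Real.norm_eq_abs, Real.abs_exp]
      exact hy.2.symm
    have hi := hprod.integral_prod_left
    refine ⟨hi.sub (integrable_const 1), ?_⟩
    simp only [hq]
    rw [integral_sub hi (integrable_const 1), integral_integral_swap hprod,
      integral_congr_ae (hG.mono fun y hy => hy.2)]
    simp
  -- The expectation is `(1 + q) exp(-q)`, and `1 + q ≤ exp q`.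
  have hone : ∀ x i, ∫⁻ ω, ENNReal.ofReal (Real.exp (quadExponent s x (Y i ω) - q x)) ∂P ≤ 1 := by
    intro x i
    have hm : Measurable fun y => ENNReal.ofReal (Real.exp (quadExponent s x y - q x)) :=
      ((hT2 x).sub_const _).exp.ennreal_ofReal
    rw [← lintegral_map hm (hY i), hlaw i]
    have hi := (integrable_exp_quadExponent (s := s) hB x).mul_const (Real.exp (-q x))
    simp only [sub_eq_add_neg, Real.exp_add]
    rw [← ofReal_integral_eq_lintegral_ofReal hi
      (Filter.Eventually.of_forall fun y => by positivity), integral_mul_const,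
      show ∫ y, Real.exp (quadExponent s x y) ∂ρ = q x + 1 by simp [hq], ENNReal.ofReal_le_one]
    calc (q x + 1) * Real.exp (-q x) ≤ Real.exp (q x) * Real.exp (-q x) := by
          gcongr; exact Real.add_one_le_exp _
      _ = 1 := by rw [← Real.exp_add]; simp
  set F : Ω → E → ENNReal := fun ω x =>
    ENNReal.ofReal (Real.exp (∑ i, (quadExponent s x (Y i ω) - q x))) with hF
  have hFm : Measurable (Function.uncurry F) := by
    refine (Finset.measurable_sum _ fun i _ => ?_).exp.ennreal_ofReal
    exact (hTm.comp (measurable_snd.prodMk ((hY i).comp measurable_fst))).sub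
      (hqm.comp measurable_snd)
  set M : Ω → ENNReal := fun ω => ∫⁻ x, F ω x ∂stdGaussian E
  have hMm : Measurable M := hFm.lintegral_prod_right
  have hM1 : ∫⁻ ω, M ω ∂P ≤ 1 := by
    rw [lintegral_lintegral_swap hFm.aemeasurable]
    calc ∫⁻ x, ∫⁻ ω, F ω x ∂P ∂stdGaussian E ≤ ∫⁻ x, 1 ∂stdGaussian E := by
          refine lintegral_mono fun x => ?_
          have e : ∀ ω, F ω x =
              ∏ i, ENNReal.ofReal (Real.exp (quadExponent s x (Y i ω) - q x)) := by
            intro ω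
            simp only [hF]
            rw [Real.exp_sum, ENNReal.ofReal_prod_of_nonneg fun i _ => (Real.exp_pos _).le]
          have hm : Measurable fun y => ENNReal.ofReal (Real.exp (quadExponent s x y - q x)) :=
            ((hT2 x).sub_const _).exp.ennreal_ofReal
          simp only [e]
          rw [lintegral_prod_eq_prod_lintegral_of_indepFun Finset.univ
            (fun i ω => ENNReal.ofReal (Real.exp (quadExponent s x (Y i ω) - q x)))
            (hind.comp (fun _ y => ENNReal.ofReal (Real.exp (quadExponent s x y - q x)))
              fun _ => hm) fun i => hm.comp (hY i)]
          exact Finset.prod_le_one' fun i _ => hone x i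
      _ = 1 := by simp
  -- Markov's inequality for the mixture `M`. The event does not involve `τ`, hence the uniformity.
  refine ⟨{ω | M ω ≤ ENNReal.ofReal ε⁻¹}, measurableSet_le hMm measurable_const, ?_, ?_⟩
  · have hmk := mul_meas_ge_le_lintegral (μ := P) hMm (ENNReal.ofReal ε⁻¹)
    have hsub : {ω | M ω ≤ ENNReal.ofReal ε⁻¹}ᶜ ⊆ {ω | ENNReal.ofReal ε⁻¹ ≤ M ω} := by
      intro ω hω
      exact (not_le.mp (show ¬ M ω ≤ _ from hω)).le
    calc P {ω | M ω ≤ ENNReal.ofReal ε⁻¹}ᶜ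
        ≤ P {ω | ENNReal.ofReal ε⁻¹ ≤ M ω} := measure_mono hsub
      _ = ENNReal.ofReal ε * (ENNReal.ofReal ε⁻¹ * P {ω | ENNReal.ofReal ε⁻¹ ≤ M ω}) := by
          rw [← mul_assoc, ← ENNReal.ofReal_mul hε.le, mul_inv_cancel₀ hε.ne', ENNReal.ofReal_one,
            one_mul]
      _ ≤ ENNReal.ofReal ε * 1 := by gcongr; exact hmk.trans hM1
      _ = _ := mul_one _
  · intro ω hω τ
    have hi : ∀ i, Integrable (fun x => quadExponent s (τ + x) (Y i ω) - q (τ + x))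
        (stdGaussian E) := fun i => (integral_quadExponent s τ (Y i ω)).1.sub (hqi τ).1
    have hfm : Measurable fun x => ∑ i, (quadExponent s x (Y i ω) - q x) :=
      Finset.measurable_sum _ fun i _ =>
        (hTm.comp (measurable_id.prodMk measurable_const)).sub hqm
    have hDV := integral_shift_le (τ := τ) (f := fun x => ∑ i, (quadExponent s x (Y i ω) - q x))
      hfm (b := Real.log ε⁻¹) (integrable_finsetSum _ fun i _ => hi i) (by
        rw [Real.exp_log (inv_pos.mpr hε)]
        exact hω)
    rw [integral_finsetSum _ fun i _ => hi i] at hDV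
    have e : ∀ i, ∫ x, (quadExponent s (τ + x) (Y i ω) - q (τ + x)) ∂stdGaussian E =
        s * ((inner ℝ τ (Y i ω)) ^ 2 - 1) - (∫ y, quadLaplace s τ y ∂ρ - 1) := by
      intro i
      rw [integral_sub (integral_quadExponent s τ (Y i ω)).1 (hqi τ).1, (hqi τ).2,
        (integral_quadExponent s τ (Y i ω)).2]
    simp only [e, Finset.sum_sub_distrib, Finset.sum_const, Finset.card_univ, Fintype.card_fin,
      nsmul_eq_mul] at hDV
    simp only [Finset.sum_sub_distrib, mul_sub, Finset.sum_const, Finset.card_univ,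
      Fintype.card_fin, nsmul_eq_mul] at hDV ⊢
    linarith

end PacBayes

/-! ### Scalar inequalities for the truncated exponentials -/

section RealInequalities

theorem exp_neg_le_quadratic {x : ℝ} (hx : 0 ≤ x) : Real.exp (-x) ≤ 1 - x + x ^ 2 / 2 := by
  have h := Real.quadratic_le_exp_of_nonneg hx
  rw [Real.exp_neg, inv_le_iff_one_le_mul₀ (Real.exp_pos x)]
  nlinarith [sq_nonneg (1 - x), sq_nonneg (x ^ 2)]

theorem exp_le_one_add_add_sq {x : ℝ} (hx : |x| ≤ 1) : Real.exp x ≤ 1 + x + x ^ 2 := by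
  have h := (abs_le.mp (Real.abs_exp_sub_one_sub_id_le hx)).2
  linarith

/-- This dictates the weight `(1 - u²/3)₊`. The function `(1 + v + v²/2) exp(v³/3 - v)` equals `1`
at `0`, and its derivative is an exponential times `v²/2 + v³ + v⁴/2`. -/
theorem exp_sub_cube_le {v : ℝ} (hv : 0 ≤ v) :
    Real.exp (v - v ^ 3 / 3) ≤ 1 + v + v ^ 2 / 2 := by
  set g : ℝ → ℝ := fun v => (1 + v + v ^ 2 / 2) * Real.exp (v ^ 3 / 3 - v) with hg
  have hd : ∀ x : ℝ, HasDerivAt g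
      ((1 + x) * Real.exp (x ^ 3 / 3 - x) +
        (1 + x + x ^ 2 / 2) * (Real.exp (x ^ 3 / 3 - x) * (x ^ 2 - 1))) x := by
    intro x
    have h1 : HasDerivAt (fun v : ℝ => 1 + v + v ^ 2 / 2) (1 + x) x := by
      refine (((hasDerivAt_id' x).const_add 1).add
        ((hasDerivAt_pow 2 x).div_const 2)).congr_deriv ?_
      norm_num
    have h2 : HasDerivAt (fun v : ℝ => v ^ 3 / 3 - v) (x ^ 2 - 1) x := by
      refine (((hasDerivAt_pow 3 x).div_const 3).sub (hasDerivAt_id' x)).congr_deriv ?_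
      norm_num
    exact h1.mul h2.exp
  have hmono : MonotoneOn g (Set.Ici 0) := by
    refine monotoneOn_of_deriv_nonneg (convex_Ici 0)
      (fun x _ => (hd x).continuousAt.continuousWithinAt)
      (fun x _ => (hd x).differentiableAt.differentiableWithinAt) fun x hx => ?_
    rw [interior_Ici, Set.mem_Ioi] at hx
    rw [(hd x).deriv]
    have e : (1 + x) * Real.exp (x ^ 3 / 3 - x) +
        (1 + x + x ^ 2 / 2) * (Real.exp (x ^ 3 / 3 - x) * (x ^ 2 - 1)) =
        Real.exp (x ^ 3 / 3 - x) * (x ^ 2 / 2 + x ^ 3 + x ^ 4 / 2) := by ring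
    rw [e]
    positivity
  have h := hmono Set.self_mem_Ici (Set.mem_Ici.mpr hv) hv
  have h0 : g 0 = 1 := by simp [hg]
  rw [h0, hg] at h
  calc Real.exp (v - v ^ 3 / 3) = Real.exp (v - v ^ 3 / 3) * 1 := (mul_one _).symm
    _ ≤ Real.exp (v - v ^ 3 / 3) * ((1 + v + v ^ 2 / 2) * Real.exp (v ^ 3 / 3 - v)) := by gcongr
    _ = (1 + v + v ^ 2 / 2) * Real.exp ((v - v ^ 3 / 3) + (v ^ 3 / 3 - v)) := by
        rw [Real.exp_add]; ring
    _ = _ := by simp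

/-- Compensating by `exp(-a)` cancels the first-order growth of `(1 - 2a)^{-1/2}`, so smoothing
costs only second order in `a`. -/
theorem exp_neg_mul_inv_sqrt_le {a : ℝ} (h0 : 0 ≤ a) (h1 : a ≤ 1 / 6) :
    Real.exp (-a) * (√(1 - 2 * a))⁻¹ ≤ Real.exp (2 * a ^ 2) := by
  have hpos : 0 < √(1 - 2 * a) := Real.sqrt_pos.mpr (by linarith)
  rw [mul_inv_le_iff₀ hpos, ← div_le_iff₀' (Real.exp_pos _), ← Real.exp_sub]
  refine Real.le_sqrt_of_sq_le ?_
  rw [← Real.exp_nat_mul]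
  have h := exp_neg_le_quadratic (x := 2 * a + 4 * a ^ 2) (by positivity)
  have e : ((2 : ℕ) : ℝ) * (-a - 2 * a ^ 2) = -(2 * a + 4 * a ^ 2) := by push_cast; ring
  rw [e]
  nlinarith [mul_nonneg h0 h0, mul_nonneg (mul_nonneg h0 h0) h0,
    mul_nonneg (mul_nonneg h0 h0) (sub_nonneg.mpr h1),
    mul_nonneg (mul_nonneg (mul_nonneg h0 h0) h0) (sub_nonneg.mpr h1)]

theorem exp_mul_inv_sqrt_le {a : ℝ} (h0 : 0 ≤ a) :
    Real.exp a * (√(1 + 2 * a))⁻¹ ≤ Real.exp (a ^ 2) := by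
  have hpos : 0 < √(1 + 2 * a) := Real.sqrt_pos.mpr (by linarith)
  rw [mul_inv_le_iff₀ hpos, ← div_le_iff₀' (Real.exp_pos _), ← Real.exp_sub]
  refine Real.le_sqrt_of_sq_le ?_
  rw [← Real.exp_nat_mul, ← Real.le_log_iff_exp_le (by linarith)]
  refine le_trans ?_ (Real.le_log_one_add_of_nonneg (x := 2 * a) (by linarith))
  rw [le_div_iff₀ (by linarith)]
  push_cast
  nlinarith [mul_nonneg (mul_nonneg h0 h0) h0]

/-- `exp(-·)` is 1-Lipschitz on `[0, ∞)`. -/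
theorem exp_neg_le_exp_neg_add {x y : ℝ} (hy : 0 ≤ y) (hxy : y ≤ x) :
    Real.exp (-y) ≤ Real.exp (-x) + (x - y) := by
  have h1 : Real.exp (-y) ≤ 1 := Real.exp_le_one_iff.mpr (by linarith)
  have h2 := Real.add_one_le_exp (-(x - y))
  have h3 : Real.exp (-x) = Real.exp (-y) * Real.exp (-(x - y)) := by
    rw [← Real.exp_add]; congr 1; ring
  rw [h3]
  have := (Real.exp_pos (-y)).le
  nlinarith

/-- The weight `(1 - u² / 3)₊`. -/
noncomputable def upperWeight (u : ℝ) : ℝ := max (1 - u ^ 2 / 3) 0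

/-- The weight `min (1, b / u)`. -/
noncomputable def lowerWeight (b u : ℝ) : ℝ := b / max b u

theorem mul_upperWeight_le {u : ℝ} (hu : 0 ≤ u) : u * upperWeight u ≤ 2 / 3 := by
  unfold upperWeight
  rcases le_total (1 - u ^ 2 / 3) 0 with h | h
  · rw [max_eq_right h]; norm_num
  · rw [max_eq_left h]
    -- `u - u³/3` is largest at `u = 1`: `2 - 3u + u³ = (u - 1)²(u + 2)`.
    nlinarith [mul_nonneg (sq_nonneg (u - 1)) (by linarith : 0 ≤ u + 2)]

theorem upperWeight_nonneg (u : ℝ) : 0 ≤ upperWeight u := le_max_right _ _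

theorem upperWeight_le_one (u : ℝ) : upperWeight u ≤ 1 :=
  max_le (by nlinarith [sq_nonneg u]) zero_le_one

theorem lowerWeight_nonneg {b u : ℝ} (hb : 0 < b) : 0 ≤ lowerWeight b u :=
  div_nonneg hb.le (hb.le.trans (le_max_left _ _))

theorem lowerWeight_le_one {b u : ℝ} (hb : 0 < b) : lowerWeight b u ≤ 1 :=
  div_le_one_of_le₀ (le_max_left _ _) (hb.le.trans (le_max_left _ _))

theorem mul_lowerWeight_div_le {b u : ℝ} (hb : 0 < b) : u * lowerWeight b u / b ≤ 1 := by
  have hm : 0 < max b u := hb.trans_le (le_max_left _ _)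
  have : u * lowerWeight b u / b = u / max b u := by unfold lowerWeight; field_simp
  rw [this]
  exact div_le_one_of_le₀ (le_max_right _ _) hm.le

theorem one_sub_lowerWeight_le {b u : ℝ} (hb : 0 < b) (hu : 0 ≤ u) :
    1 - lowerWeight b u ≤ u / b := by
  unfold lowerWeight
  rcases le_total b u with h | h
  · rw [max_eq_right h]
    have h1 : 1 ≤ u / b := (one_le_div hb).mpr h
    have h2 : 0 ≤ b / u := div_nonneg hb.le hu
    linarith
  · rw [max_eq_left h, div_self hb.ne', sub_self]
    positivity

/-- The truncation turns the main factor `exp(v w)` into `1 + v + v²/2`. The rest is `exp z` with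
`z` small, since `u w ≤ 2/3` and `b ≥ 9` give `a ≤ 2/27`. The application has `u = l‖V‖²`, `v = l⟨θ,
V⟩²`, `b = β`. -/
theorem upper_laplace_le {u v b : ℝ} (hv : 0 ≤ v) (hvu : v ≤ u) (hb : 9 ≤ b) :
    Real.exp (-(u * upperWeight u / b)) * (√(1 - 2 * (u * upperWeight u / b)))⁻¹ *
      Real.exp (v * upperWeight u / (1 - 2 * (u * upperWeight u / b))) ≤
      1 + v + v ^ 2 / 2 + 6 * (v * (u / b)) + 5 * (u / b) ^ 2 := by
  have hu : 0 ≤ u := hv.trans hvu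
  have hb0 : 0 < b := by linarith
  have hw0 := upperWeight_nonneg u
  have hw1 := upperWeight_le_one u
  have huw := mul_upperWeight_le hu
  have hvw : v * upperWeight u ≤ 2 / 3 := (mul_le_mul_of_nonneg_right hvu hw0).trans huw
  have hE : Real.exp (v * upperWeight u) ≤ 1 + v + v ^ 2 / 2 := by
    unfold upperWeight
    rcases le_total (1 - u ^ 2 / 3) 0 with h | h
    · rw [max_eq_right h, mul_zero, Real.exp_zero]
      nlinarith [sq_nonneg v]
    · rw [max_eq_left h]
      refine le_trans (Real.exp_le_exp.mpr ?_) (exp_sub_cube_le hv)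
      have : v * v ^ 2 ≤ v * u ^ 2 := by gcongr
      nlinarith
  set w := upperWeight u
  set a := u * w / b with ha
  have ha0 : 0 ≤ a := by positivity
  have hau : a ≤ u / b := by
    rw [ha]; gcongr; exact mul_le_of_le_one_right hu hw1
  have ha1 : a ≤ 2 / 27 := by
    rw [ha, div_le_iff₀ hb0]; linarith
  have hvw0 : 0 ≤ v * w := mul_nonneg hv hw0
  have hvwv : v * w ≤ v := mul_le_of_le_one_right hv hw1
  set z := 12 / 5 * (a * (v * w)) + 2 * a ^ 2 with hz
  have hz0 : 0 ≤ z := by positivity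
  have havw : a * (v * w) ≤ 2 / 27 * (2 / 3) := by gcongr
  have ha2 : a ^ 2 ≤ (2 / 27) ^ 2 := by gcongr
  have hz1 : z ≤ 13 / 100 := by rw [hz]; linarith
  have hz2 : z ≤ 12 / 5 * (v * (u / b)) + 2 * (u / b) ^ 2 := by
    rw [hz]
    have : a * (v * w) ≤ u / b * v := by gcongr
    have : a ^ 2 ≤ (u / b) ^ 2 := by gcongr
    linarith
  have hez : Real.exp z ≤ 1 + 113 / 100 * z := by
    have := exp_le_one_add_add_sq (x := z) (by rw [abs_of_nonneg hz0]; linarith)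
    nlinarith
  -- `19/9 = 1 + 2/3 + (2/3)²`. Multiplied by `1.13`, it takes the coefficients `12/5` and `2` of
  -- `z` below `6` and `5`.
  have hE2 : Real.exp (v * w) ≤ 19 / 9 := by
    have := exp_le_one_add_add_sq (x := v * w) (by rw [abs_of_nonneg hvw0]; linarith)
    have h2 : (v * w) ^ 2 ≤ (2 / 3) ^ 2 := by gcongr
    linarith
  have hdiv : v * w / (1 - 2 * a) ≤ v * w + 12 / 5 * (a * (v * w)) := by
    rw [div_le_iff₀ (by linarith)]
    have : 0 ≤ a * (v * w) * (2 / 5 - 24 / 5 * a) := mul_nonneg (by positivity) (by linarith)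
    nlinarith
  calc Real.exp (-a) * (√(1 - 2 * a))⁻¹ * Real.exp (v * w / (1 - 2 * a))
      ≤ Real.exp (2 * a ^ 2) * Real.exp (v * w + 12 / 5 * (a * (v * w))) := by
        gcongr
        exact exp_neg_mul_inv_sqrt_le ha0 (by linarith)
    _ = Real.exp (v * w) * Real.exp z := by
        rw [← Real.exp_add, ← Real.exp_add, hz]; congr 1; ring
    _ ≤ Real.exp (v * w) * (1 + 113 / 100 * z) := by gcongr
    _ = Real.exp (v * w) + Real.exp (v * w) * (113 / 100 * z) := by ring
    _ ≤ (1 + v + v ^ 2 / 2) + 19 / 9 * (113 / 100 * z) := by gcongr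
    _ ≤ _ := by
        have : 0 ≤ v * (u / b) := by positivity
        have : 0 ≤ (u / b) ^ 2 := by positivity
        linarith

/-- Here the exponent is negative, so a quadratic bound holds without truncation. The weight only
ensures `a ≤ 1`; it and the denominator lower the exponent by at most `3 v u / b`, which costs no
more than that by the Lipschitz bound. -/
theorem lower_laplace_le {u v b : ℝ} (hv : 0 ≤ v) (hu : 0 ≤ u) (hb : 0 < b) :
    Real.exp (u * lowerWeight b u / b) * (√(1 + 2 * (u * lowerWeight b u / b)))⁻¹ *
      Real.exp (-(v * lowerWeight b u / (1 + 2 * (u * lowerWeight b u / b)))) ≤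
      1 - v + v ^ 2 / 2 + 3 * (v * (u / b)) + 2 * (u / b) ^ 2 := by
  have hw0 := lowerWeight_nonneg (u := u) hb
  have hw1 := lowerWeight_le_one (u := u) hb
  have ha1 := mul_lowerWeight_div_le (u := u) hb
  have hw2 := one_sub_lowerWeight_le hb hu
  set w := lowerWeight b u
  set a := u * w / b with ha
  have ha0 : 0 ≤ a := by positivity
  have hau : a ≤ u / b := by
    rw [ha]; gcongr; exact mul_le_of_le_one_right hu hw1
  set y := v * w / (1 + 2 * a) with hy
  have hy0 : 0 ≤ y := by positivity
  have hvy : v - y ≤ 3 * (v * (u / b)) := by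
    have e : v - y = v * (1 - w + 2 * a) / (1 + 2 * a) := by rw [hy]; field_simp; ring
    have h0 : 0 ≤ 1 - w + 2 * a := by linarith
    calc v - y = v * (1 - w + 2 * a) / (1 + 2 * a) := e
      _ ≤ v * (1 - w + 2 * a) := div_le_self (mul_nonneg hv h0) (by linarith)
      _ ≤ v * (u / b + 2 * (u / b)) := by gcongr
      _ = _ := by ring
  have hyv : y ≤ v := by
    rw [hy, div_le_iff₀ (by linarith)]
    nlinarith [mul_le_of_le_one_right hv hw1, mul_nonneg hv ha0]
  have hE := exp_neg_le_exp_neg_add hy0 hyv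
  have hE1 : Real.exp (-y) ≤ 1 := Real.exp_le_one_iff.mpr (by linarith)
  have hv2 := exp_neg_le_quadratic hv
  have ha2 : a ^ 2 ≤ 1 := pow_le_one₀ ha0 ha1
  have hea : Real.exp (a ^ 2) ≤ 1 + 2 * a ^ 2 := by
    have := exp_le_one_add_add_sq (x := a ^ 2) (by rw [abs_of_nonneg (sq_nonneg a)]; exact ha2)
    nlinarith [sq_nonneg a]
  have ha3 : a ^ 2 ≤ (u / b) ^ 2 := by gcongr
  calc Real.exp a * (√(1 + 2 * a))⁻¹ * Real.exp (-y)
      ≤ (1 + 2 * a ^ 2) * Real.exp (-y) := by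
        gcongr
        exact (exp_mul_inv_sqrt_le ha0).trans hea
    _ = Real.exp (-y) + 2 * a ^ 2 * Real.exp (-y) := by ring
    _ ≤ Real.exp (-y) + 2 * a ^ 2 * 1 := by gcongr
    _ ≤ _ := by linarith

end RealInequalities

/-! ### Moments of the norm from moments of the marginals -/

section Moments

theorem inner_sq_le_of_norm_eq_one {E : Type*} [NormedAddCommGroup E]
    [InnerProductSpace ℝ E] {θ : E} (hθ : ‖θ‖ = 1) (v : E) :
    (inner ℝ θ v : ℝ) ^ 2 ≤ ‖v‖ ^ 2 := by
  have h := abs_real_inner_le_norm θ v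
  rw [hθ, one_mul] at h
  rw [← sq_abs]
  gcongr

theorem integral_one_add_four_terms {α : Type*} [MeasurableSpace α] {μ : Measure α}
    [IsProbabilityMeasure μ] {f₁ f₂ f₃ f₄ : α → ℝ} (h₁ : Integrable f₁ μ) (h₂ : Integrable f₂ μ)
    (h₃ : Integrable f₃ μ) (h₄ : Integrable f₄ μ) (c₁ c₂ c₃ c₄ : ℝ) :
    Integrable (fun x => 1 + c₁ * f₁ x + c₂ * f₂ x + c₃ * f₃ x + c₄ * f₄ x) μ ∧
    ∫ x, (1 + c₁ * f₁ x + c₂ * f₂ x + c₃ * f₃ x + c₄ * f₄ x) ∂μ =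
      1 + c₁ * ∫ x, f₁ x ∂μ + c₂ * ∫ x, f₂ x ∂μ + c₃ * ∫ x, f₃ x ∂μ + c₄ * ∫ x, f₄ x ∂μ := by
  have j1 : Integrable (fun x => 1 + c₁ * f₁ x) μ := (integrable_const 1).add (h₁.const_mul c₁)
  have j2 : Integrable (fun x => 1 + c₁ * f₁ x + c₂ * f₂ x) μ := j1.add (h₂.const_mul c₂)
  have j3 : Integrable (fun x => 1 + c₁ * f₁ x + c₂ * f₂ x + c₃ * f₃ x) μ :=
    j2.add (h₃.const_mul c₃)
  refine ⟨j3.add (h₄.const_mul c₄), ?_⟩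
  rw [integral_add j3 (h₄.const_mul c₄), integral_add j2 (h₃.const_mul c₃),
    integral_add j1 (h₂.const_mul c₂), integral_add (integrable_const 1) (h₁.const_mul c₁)]
  simp [integral_const_mul]

variable {E : Type*} [NormedAddCommGroup E] [InnerProductSpace ℝ E] [FiniteDimensional ℝ E]
  [MeasurableSpace E] [BorelSpace E]

variable {ρ : Measure E}

theorem integrable_inner_sq [IsProbabilityMeasure ρ] (hi : Integrable (fun v : E => ‖v‖ ^ 4) ρ)
    {θ : E} (hθ : ‖θ‖ = 1) : Integrable (fun v : E => (inner ℝ θ v : ℝ) ^ 2) ρ := by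
  refine (hi.add (integrable_const 1)).mono' (by fun_prop) (Filter.Eventually.of_forall fun v => ?_)
  rw [Real.norm_of_nonneg (sq_nonneg _)]
  have := inner_sq_le_of_norm_eq_one hθ v
  simp only [Pi.add_apply]
  nlinarith [sq_nonneg (‖v‖ ^ 2 - 1), sq_nonneg (‖v‖ ^ 2)]

theorem integrable_norm_sq_mul_inner_sq (hi : Integrable (fun v : E => ‖v‖ ^ 4) ρ) {θ : E}
    (hθ : ‖θ‖ = 1) : Integrable (fun v : E => ‖v‖ ^ 2 * (inner ℝ θ v : ℝ) ^ 2) ρ := by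
  refine hi.mono' (by fun_prop) (Filter.Eventually.of_forall fun v => ?_)
  rw [Real.norm_of_nonneg (by positivity)]
  calc ‖v‖ ^ 2 * (inner ℝ θ v : ℝ) ^ 2 ≤ ‖v‖ ^ 2 * ‖v‖ ^ 2 := by
        exact mul_le_mul_of_nonneg_left (inner_sq_le_of_norm_eq_one hθ v) (sq_nonneg _)
    _ = ‖v‖ ^ 4 := by ring

theorem integrable_inner_pow_four (hi : Integrable (fun v : E => ‖v‖ ^ 4) ρ) {θ : E}
    (hθ : ‖θ‖ = 1) : Integrable (fun v : E => (inner ℝ θ v : ℝ) ^ 4) ρ := by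
  refine hi.mono' (by fun_prop) (Filter.Eventually.of_forall fun v => ?_)
  rw [Real.norm_of_nonneg (by positivity)]
  calc (inner ℝ θ v : ℝ) ^ 4 = ((inner ℝ θ v : ℝ) ^ 2) ^ 2 := by ring
    _ ≤ (‖v‖ ^ 2) ^ 2 := pow_le_pow_left₀ (sq_nonneg _) (inner_sq_le_of_norm_eq_one hθ v) 2
    _ = ‖v‖ ^ 4 := by ring

theorem integral_norm_sq_mul_inner_sq_le (hi : Integrable (fun v : E => ‖v‖ ^ 4) ρ) {K : ℝ}
    (hK : ∀ θ : E, ‖θ‖ = 1 → ∫ v, (inner ℝ θ v : ℝ) ^ 4 ∂ρ ≤ K) {θ : E} (hθ : ‖θ‖ = 1) :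
    ∫ v, ‖v‖ ^ 2 * (inner ℝ θ v : ℝ) ^ 2 ∂ρ ≤ K * Module.finrank ℝ E := by
  set b := stdOrthonormalBasis ℝ E
  have hb : ∀ i, ‖b i‖ = 1 := fun i => b.norm_eq_one i
  have i4 : ∀ i, Integrable (fun v : E => ((inner ℝ (b i) v : ℝ) ^ 4 + (inner ℝ θ v : ℝ) ^ 4) / 2)
      ρ := fun i => ((integrable_inner_pow_four hi (hb i)).add
        (integrable_inner_pow_four hi hθ)).div_const 2
  calc ∫ v, ‖v‖ ^ 2 * (inner ℝ θ v : ℝ) ^ 2 ∂ρ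
      ≤ ∫ v, ∑ i, ((inner ℝ (b i) v : ℝ) ^ 4 + (inner ℝ θ v : ℝ) ^ 4) / 2 ∂ρ := by
        refine integral_mono (integrable_norm_sq_mul_inner_sq hi hθ)
          (integrable_finsetSum _ fun i _ => i4 i) fun v => ?_
        simp only
        rw [← b.sum_sq_inner_right v, Finset.sum_mul]
        refine Finset.sum_le_sum fun i _ => ?_
        -- `xy ≤ (x² + y²)/2` in each coordinate of an orthonormal basis: this is how the dimension
        -- enters.
        nlinarith [sq_nonneg ((inner ℝ (b i) v : ℝ) ^ 2 - (inner ℝ θ v : ℝ) ^ 2)]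
    _ = ∑ i, ∫ v, ((inner ℝ (b i) v : ℝ) ^ 4 + (inner ℝ θ v : ℝ) ^ 4) / 2 ∂ρ :=
        integral_finsetSum _ fun i _ => i4 i
    _ ≤ ∑ _i : Fin (Module.finrank ℝ E), K := by
        refine Finset.sum_le_sum fun i _ => ?_
        rw [integral_div, integral_add (integrable_inner_pow_four hi (hb i))
          (integrable_inner_pow_four hi hθ)]
        linarith [hK _ (hb i), hK _ hθ]
    _ = _ := by simp [mul_comm]

theorem integral_norm_pow_four_le (hi : Integrable (fun v : E => ‖v‖ ^ 4) ρ) {K : ℝ}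
    (hK : ∀ θ : E, ‖θ‖ = 1 → ∫ v, (inner ℝ θ v : ℝ) ^ 4 ∂ρ ≤ K) :
    ∫ v, ‖v‖ ^ 4 ∂ρ ≤ K * (Module.finrank ℝ E : ℝ) ^ 2 := by
  set b := stdOrthonormalBasis ℝ E
  have hb : ∀ i, ‖b i‖ = 1 := fun i => b.norm_eq_one i
  calc ∫ v, ‖v‖ ^ 4 ∂ρ = ∫ v, ∑ i, ‖v‖ ^ 2 * (inner ℝ (b i) v : ℝ) ^ 2 ∂ρ := by
        refine integral_congr_ae (Filter.Eventually.of_forall fun v => ?_)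
        simp only
        rw [← Finset.mul_sum, b.sum_sq_inner_right v]
        ring
    _ = ∑ i, ∫ v, ‖v‖ ^ 2 * (inner ℝ (b i) v : ℝ) ^ 2 ∂ρ :=
        integral_finsetSum _ fun i _ => integrable_norm_sq_mul_inner_sq hi (hb i)
    _ ≤ ∑ _i : Fin (Module.finrank ℝ E), K * Module.finrank ℝ E :=
        Finset.sum_le_sum fun i _ => integral_norm_sq_mul_inner_sq_le hi hK (hb i)
    _ = _ := by simp; ring

end Moments

/-! ### Deviation inequalities, uniform over the unit sphere -/

section Deviation

variable {E : Type*} [NormedAddCommGroup E] [InnerProductSpace ℝ E] [FiniteDimensional ℝ E]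
  [MeasurableSpace E] [BorelSpace E] {ρ : Measure E} [IsProbabilityMeasure ρ]
  {Ω : Type*} [MeasurableSpace Ω] {P : Measure Ω} [IsProbabilityMeasure P]
  {n : ℕ} {V : Fin n → Ω → E}

/-- Uniform deviation bound for weighted quadratic forms. -/
theorem weighted_quadratic_deviation (hV : ∀ i, Measurable (V i)) (hind : iIndepFun V P)
    (hlaw : ∀ i, P.map (V i) = ρ) {w : E → ℝ} (hw : Measurable w) (hw0 : ∀ v, 0 ≤ w v)
    {s β c : ℝ} (hβ : 0 < β) (hc : 0 < c) (hwc : ∀ v, c * (w v * ‖v‖ ^ 2 / β) ≤ 1)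
    (hws : ∀ v, s * (w v * ‖v‖ ^ 2 / β) ≤ 1 / 4) {ε : ℝ} (hε : 0 < ε) :
    ∃ A : Set Ω, MeasurableSet A ∧ P Aᶜ ≤ ENNReal.ofReal ε ∧ ∀ ω ∈ A, ∀ θ : E, ‖θ‖ = 1 →
      ∀ I : ℝ, (∫ v, Real.exp (-s) * (Real.exp (-(s * (w v * ‖v‖ ^ 2 / β))) *
        (√(1 - 2 * (s * (w v * ‖v‖ ^ 2 / β))))⁻¹ *
          Real.exp (s * (w v * (inner ℝ θ v : ℝ) ^ 2) /
            (1 - 2 * (s * (w v * ‖v‖ ^ 2 / β))))) ∂ρ) ≤ I →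
      ∑ i, s * (w (V i ω) * (inner ℝ θ (V i ω)) ^ 2 - 1) ≤
        n * (I - 1) + (β / 2 + Real.log ε⁻¹) := by
  -- Putting the weight into the vector and the scale `√β` into the direction gives `⟨√β θ, f v⟩² =
  -- w ⟨θ, v⟩²`, `‖f v‖² = w ‖v‖² / β`, and entropy `β/2`.
  set f : E → E := fun v => √(w v / β) • v with hf
  have hfm : Measurable f := (hw.div_const β).sqrt.smul measurable_id
  have hnorm : ∀ v, ‖f v‖ ^ 2 = w v * ‖v‖ ^ 2 / β := by
    intro v
    rw [hf]
    simp only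
    rw [norm_smul, mul_pow, Real.norm_eq_abs, sq_abs,
      Real.sq_sqrt (div_nonneg (hw0 v) hβ.le)]
    ring
  have hinner : ∀ θ v : E, (inner ℝ (√β • θ) (f v) : ℝ) ^ 2 = w v * (inner ℝ θ v : ℝ) ^ 2 := by
    intro θ v
    rw [hf]
    simp only
    rw [real_inner_smul_left, real_inner_smul_right, mul_pow, mul_pow, Real.sq_sqrt hβ.le,
      Real.sq_sqrt (div_nonneg (hw0 v) hβ.le)]
    field_simp
  have hprob : IsProbabilityMeasure (ρ.map f) := Measure.isProbabilityMeasure_map hfm.aemeasurable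
  have hB : ∀ᵐ y ∂ρ.map f, ‖y‖ ≤ √(1 / c) := by
    rw [ae_map_iff hfm.aemeasurable (measurableSet_le measurable_norm measurable_const)]
    refine Filter.Eventually.of_forall fun v => Real.le_sqrt_of_sq_le ?_
    rw [hnorm, le_div_iff₀ hc, mul_comm]
    exact hwc v
  have hs : ∀ᵐ y ∂ρ.map f, s * ‖y‖ ^ 2 ≤ 1 / 4 := by
    rw [ae_map_iff hfm.aemeasurable (measurableSet_le (by fun_prop) measurable_const)]
    refine Filter.Eventually.of_forall fun v => ?_
    rw [hnorm]
    exact hws v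
  obtain ⟨A, hA, hPA, hAb⟩ := pacBayes_quadratic (Y := fun i ω => f (V i ω)) (P := P)
    (fun i => hfm.comp (hV i)) (hind.comp (fun _ => f) fun _ => hfm) (ρ := ρ.map f)
    (fun i => by rw [← hlaw i, Measure.map_map hfm (hV i)]; rfl) hB hs hε
  refine ⟨A, hA, hPA, fun ω hω θ hθ I hI => ?_⟩
  have h := hAb ω hω (√β • θ)
  simp only [hinner] at h
  rw [integral_map hfm.aemeasurable (measurable_quadLaplace _ _).aestronglyMeasurable,
    norm_smul, hθ, mul_one, Real.norm_eq_abs, sq_abs, Real.sq_sqrt hβ.le] at h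
  simp only [quadLaplace, hnorm, hinner] at h
  refine h.trans ?_
  gcongr

/-- Upper deviation bound. -/
theorem upper_quadratic_deviation (hV : ∀ i, Measurable (V i)) (hind : iIndepFun V P)
    (hlaw : ∀ i, P.map (V i) = ρ) (hi : Integrable (fun v : E => ‖v‖ ^ 4) ρ) {K : ℝ}
    (hK : ∀ θ : E, ‖θ‖ = 1 → ∫ v, (inner ℝ θ v : ℝ) ^ 4 ∂ρ ≤ K)
    (h2 : ∀ θ : E, ‖θ‖ = 1 → ∫ v, (inner ℝ θ v : ℝ) ^ 2 ∂ρ ≤ 1)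
    {l β : ℝ} (hl : 0 < l) (hβ : 9 ≤ β) (hβD : 9 * (Module.finrank ℝ E : ℝ) ≤ β) (hK0 : 0 ≤ K)
    {ε : ℝ} (hε : 0 < ε) :
    ∃ A : Set Ω, MeasurableSet A ∧ P Aᶜ ≤ ENNReal.ofReal ε ∧ ∀ ω ∈ A, ∀ θ : E, ‖θ‖ = 1 →
      ∑ i, l * (upperWeight (l * ‖V i ω‖ ^ 2) * (inner ℝ θ (V i ω)) ^ 2 - 1) ≤
        n * (Real.exp (-l) * (1 + l + l ^ 2 * K / 2 + 7 * (l ^ 2 * K * Module.finrank ℝ E / β)) - 1)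
          + (β / 2 + Real.log ε⁻¹) := by
  have hβ0 : 0 < β := by linarith
  have key : ∀ v : E, l * (upperWeight (l * ‖v‖ ^ 2) * ‖v‖ ^ 2 / β) =
      l * ‖v‖ ^ 2 * upperWeight (l * ‖v‖ ^ 2) / β := fun v => by ring
  have hb : ∀ v : E, l * (upperWeight (l * ‖v‖ ^ 2) * ‖v‖ ^ 2 / β) ≤ 1 / 4 := by
    intro v
    rw [key, div_le_iff₀ hβ0]
    have := mul_upperWeight_le (u := l * ‖v‖ ^ 2) (by positivity)
    linarith
  obtain ⟨A, hA, hPA, hAb⟩ := weighted_quadratic_deviation (P := P) hV hind hlaw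
    (w := fun v => upperWeight (l * ‖v‖ ^ 2)) (by unfold upperWeight; fun_prop)
    (fun v => upperWeight_nonneg _) (s := l) hβ0 hl (fun v => (hb v).trans (by norm_num)) hb hε
  refine ⟨A, hA, hPA, fun ω hω θ hθ => hAb ω hω θ hθ _ ?_⟩
  have i2 := integrable_inner_sq hi hθ
  have i4 := integrable_inner_pow_four hi hθ
  have i22 := integrable_norm_sq_mul_inner_sq hi hθ
  have m22 := integral_norm_sq_mul_inner_sq_le hi hK hθ
  have m4 := integral_norm_pow_four_le hi hK
  obtain ⟨hint, heq⟩ := integral_one_add_four_terms i2 i4 i22 hi l (l ^ 2 / 2)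
    (6 * (l ^ 2 / β)) (5 * (l ^ 2 / β ^ 2))
  rw [integral_const_mul]
  gcongr
  calc _ ≤ ∫ v, (1 + l * (inner ℝ θ v : ℝ) ^ 2 + l ^ 2 / 2 * (inner ℝ θ v : ℝ) ^ 4 +
        6 * (l ^ 2 / β) * (‖v‖ ^ 2 * (inner ℝ θ v : ℝ) ^ 2) + 5 * (l ^ 2 / β ^ 2) * ‖v‖ ^ 4) ∂ρ := by
        refine integral_mono_of_nonneg (Filter.Eventually.of_forall fun v => ?_) hint
          (Filter.Eventually.of_forall fun v => ?_)
        · simp only [Pi.zero_apply]; positivity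
        · have h := upper_laplace_le (u := l * ‖v‖ ^ 2) (v := l * (inner ℝ θ v : ℝ) ^ 2) (b := β)
            (by positivity) (mul_le_mul_of_nonneg_left (inner_sq_le_of_norm_eq_one hθ v) hl.le) hβ
          simp only
          rw [key, show l * (upperWeight (l * ‖v‖ ^ 2) * (inner ℝ θ v : ℝ) ^ 2) =
            l * (inner ℝ θ v : ℝ) ^ 2 * upperWeight (l * ‖v‖ ^ 2) by ring]
          refine h.trans (le_of_eq ?_)
          ring
    _ = 1 + l * ∫ v, (inner ℝ θ v : ℝ) ^ 2 ∂ρ + l ^ 2 / 2 * ∫ v, (inner ℝ θ v : ℝ) ^ 4 ∂ρ +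
        6 * (l ^ 2 / β) * ∫ v, ‖v‖ ^ 2 * (inner ℝ θ v : ℝ) ^ 2 ∂ρ +
        5 * (l ^ 2 / β ^ 2) * ∫ v, ‖v‖ ^ 4 ∂ρ := heq
    _ ≤ 1 + l * 1 + l ^ 2 / 2 * K + 6 * (l ^ 2 / β) * (K * Module.finrank ℝ E) +
        5 * (l ^ 2 / β ^ 2) * (K * (Module.finrank ℝ E : ℝ) ^ 2) := by
        gcongr
        · exact h2 θ hθ
        · exact hK θ hθ
    _ ≤ _ := by
        -- As `β` is at least nine times the dimension, the second-order term is absorbed into the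
        -- first-order one, raising `6` to `7`.
        have e : 5 * (l ^ 2 / β ^ 2) * (K * (Module.finrank ℝ E : ℝ) ^ 2) ≤
            l ^ 2 * K * Module.finrank ℝ E / β := by
          have h1 : (Module.finrank ℝ E : ℝ) / β ≤ 1 / 9 := by
            rw [div_le_iff₀ hβ0]; linarith
          have h0 : 0 ≤ l ^ 2 * K * Module.finrank ℝ E / β := by positivity
          calc 5 * (l ^ 2 / β ^ 2) * (K * (Module.finrank ℝ E : ℝ) ^ 2)
              = 5 * (l ^ 2 * K * Module.finrank ℝ E / β) * (Module.finrank ℝ E / β) := by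
                field_simp
            _ ≤ 5 * (l ^ 2 * K * Module.finrank ℝ E / β) * (1 / 9) := by gcongr
            _ ≤ _ := by linarith
        have e2 : 6 * (l ^ 2 / β) * (K * Module.finrank ℝ E) =
          6 * (l ^ 2 * K * Module.finrank ℝ E / β) := by ring
        rw [e2]
        linarith

/-- Lower deviation bound. -/
theorem lower_quadratic_deviation (hV : ∀ i, Measurable (V i)) (hind : iIndepFun V P)
    (hlaw : ∀ i, P.map (V i) = ρ) (hi : Integrable (fun v : E => ‖v‖ ^ 4) ρ) {K : ℝ}
    (hK : ∀ θ : E, ‖θ‖ = 1 → ∫ v, (inner ℝ θ v : ℝ) ^ 4 ∂ρ ≤ K)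
    {l β : ℝ} (hl : 0 < l) (hβ0 : 0 < β) (hβD : 9 * (Module.finrank ℝ E : ℝ) ≤ β) (hK0 : 0 ≤ K)
    {ε : ℝ} (hε : 0 < ε) :
    ∃ A : Set Ω, MeasurableSet A ∧ P Aᶜ ≤ ENNReal.ofReal ε ∧ ∀ ω ∈ A, ∀ θ : E, ‖θ‖ = 1 →
      ∫ v, (inner ℝ θ v : ℝ) ^ 2 ∂ρ = 1 →
      ∑ i, l * (1 - (inner ℝ θ (V i ω)) ^ 2) ≤
        n * (Real.exp l * (1 - l + l ^ 2 * K / 2 + 4 * (l ^ 2 * K * Module.finrank ℝ E / β)) - 1)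
          + (β / 2 + Real.log ε⁻¹) := by
  have key : ∀ v : E, l * (lowerWeight β (l * ‖v‖ ^ 2) * ‖v‖ ^ 2 / β) =
      l * ‖v‖ ^ 2 * lowerWeight β (l * ‖v‖ ^ 2) / β := fun v => by ring
  obtain ⟨A, hA, hPA, hAb⟩ := weighted_quadratic_deviation (P := P) hV hind hlaw
    (w := fun v => lowerWeight β (l * ‖v‖ ^ 2)) (by unfold lowerWeight; fun_prop)
    (fun v => lowerWeight_nonneg hβ0) (s := -l) hβ0 hl
    (fun v => by rw [key]; exact mul_lowerWeight_div_le hβ0)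
    (fun v => by
      have : 0 ≤ lowerWeight β (l * ‖v‖ ^ 2) := lowerWeight_nonneg hβ0
      have : 0 ≤ l * (lowerWeight β (l * ‖v‖ ^ 2) * ‖v‖ ^ 2 / β) := by positivity
      linarith) hε
  refine ⟨A, hA, hPA, fun ω hω θ hθ h2 => ?_⟩
  -- The weight is at most `1`, so it can be dropped from a lower bound for free; no analogue of
  -- `γ₊` appears.
  have hmono : ∑ i, l * (1 - (inner ℝ θ (V i ω)) ^ 2) ≤
      ∑ i, -l * (lowerWeight β (l * ‖V i ω‖ ^ 2) * (inner ℝ θ (V i ω)) ^ 2 - 1) := by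
    refine Finset.sum_le_sum fun i _ => ?_
    have h1 := mul_le_of_le_one_left (sq_nonneg (inner ℝ θ (V i ω) : ℝ))
      (lowerWeight_le_one (u := l * ‖V i ω‖ ^ 2) hβ0)
    nlinarith
  refine hmono.trans (hAb ω hω θ hθ _ ?_)
  have i2 := integrable_inner_sq hi hθ
  have i4 := integrable_inner_pow_four hi hθ
  have i22 := integrable_norm_sq_mul_inner_sq hi hθ
  have m22 := integral_norm_sq_mul_inner_sq_le hi hK hθ
  have m4 := integral_norm_pow_four_le hi hK
  obtain ⟨hint, heq⟩ := integral_one_add_four_terms i2 i4 i22 hi (-l) (l ^ 2 / 2)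
    (3 * (l ^ 2 / β)) (2 * (l ^ 2 / β ^ 2))
  rw [integral_const_mul, neg_neg]
  gcongr
  calc _ ≤ ∫ v, (1 + -l * (inner ℝ θ v : ℝ) ^ 2 + l ^ 2 / 2 * (inner ℝ θ v : ℝ) ^ 4 +
        3 * (l ^ 2 / β) * (‖v‖ ^ 2 * (inner ℝ θ v : ℝ) ^ 2) + 2 * (l ^ 2 / β ^ 2) * ‖v‖ ^ 4) ∂ρ := by
        refine integral_mono_of_nonneg (Filter.Eventually.of_forall fun v => ?_) hint
          (Filter.Eventually.of_forall fun v => ?_)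
        · simp only [Pi.zero_apply]; positivity
        · have h := lower_laplace_le (u := l * ‖v‖ ^ 2) (v := l * (inner ℝ θ v : ℝ) ^ 2) (b := β)
            (by positivity) (by positivity) hβ0
          simp only
          rw [neg_mul, key, show -l * (lowerWeight β (l * ‖v‖ ^ 2) * (inner ℝ θ v : ℝ) ^ 2) =
            -(l * (inner ℝ θ v : ℝ) ^ 2 * lowerWeight β (l * ‖v‖ ^ 2)) by ring, neg_neg,
            mul_neg, sub_neg_eq_add, neg_div]
          refine h.trans (le_of_eq ?_)
          ring
    _ = 1 + -l * ∫ v, (inner ℝ θ v : ℝ) ^ 2 ∂ρ + l ^ 2 / 2 * ∫ v, (inner ℝ θ v : ℝ) ^ 4 ∂ρ +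
        3 * (l ^ 2 / β) * ∫ v, ‖v‖ ^ 2 * (inner ℝ θ v : ℝ) ^ 2 ∂ρ +
        2 * (l ^ 2 / β ^ 2) * ∫ v, ‖v‖ ^ 4 ∂ρ := heq
    _ ≤ 1 + -l * 1 + l ^ 2 / 2 * K + 3 * (l ^ 2 / β) * (K * Module.finrank ℝ E) +
        2 * (l ^ 2 / β ^ 2) * (K * (Module.finrank ℝ E : ℝ) ^ 2) := by
        rw [h2]
        gcongr
        exact hK θ hθ
    _ ≤ _ := by
        have e : 2 * (l ^ 2 / β ^ 2) * (K * (Module.finrank ℝ E : ℝ) ^ 2) ≤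
            l ^ 2 * K * Module.finrank ℝ E / β := by
          have h1 : (Module.finrank ℝ E : ℝ) / β ≤ 1 / 9 := by
            rw [div_le_iff₀ hβ0]; linarith
          have h0 : 0 ≤ l ^ 2 * K * Module.finrank ℝ E / β := by positivity
          calc 2 * (l ^ 2 / β ^ 2) * (K * (Module.finrank ℝ E : ℝ) ^ 2)
              = 2 * (l ^ 2 * K * Module.finrank ℝ E / β) * (Module.finrank ℝ E / β) := by
                field_simp
            _ ≤ 2 * (l ^ 2 * K * Module.finrank ℝ E / β) * (1 / 9) := by gcongr
            _ ≤ _ := by linarith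
        have e2 : 3 * (l ^ 2 / β) * (K * Module.finrank ℝ E) =
          3 * (l ^ 2 * K * Module.finrank ℝ E / β) := by ring
        rw [e2]
        linarith

end Deviation

/-! ### Choice of parameters and orders of magnitude -/

section Parameters

theorem three_le_add_two_mul_sqrt {κ : ℝ} (hκ : 1 ≤ κ) : 3 ≤ κ + 2 * √κ := by
  have := Real.one_le_sqrt.mpr hκ
  linarith

theorem level_ge {d : ℕ} {ε : ℝ} (hε : 0 < ε) (hε1 : ε ≤ 1) :
    0.73 * ((d : ℝ) + 1) ≤ level d ε := by
  have := Real.log_nonneg ((one_le_inv₀ hε).mpr hε1)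
  unfold level
  linarith

theorem mu_eq {d n : ℕ} {κ ε : ℝ} (hκ : 0 ≤ κ) (hL : 0 ≤ level d ε) :
    mu d n κ ε = √(2 * (κ + 2 * √κ) * level d ε) / √n +
      6.81 * √2 * ((√κ + 1) * (√((d : ℝ) + 1) / √n)) := by
  unfold mu
  have h1 : 2 * (κ + 2 * √κ) / n * level d ε = 2 * (κ + 2 * √κ) * level d ε / n := by ring
  rw [h1, Real.sqrt_div (mul_nonneg (by positivity) hL), Real.sqrt_div (by positivity),
    Real.sqrt_mul (by norm_num : (0 : ℝ) ≤ 2) ((d : ℝ) + 1)]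
  ring

/-- Constants: `6.81 · 1.415 ≤ 0.485 · 20` and `1 ≤ 0.485 · 5/2`. Being below `1/2`, the bound keeps
`1 - 2μ` at least `0.03`. -/
theorem mu_le {d n : ℕ} {κ ε : ℝ} (hκ : 0 < κ) (hL : 0 ≤ level d ε)
    (hn : sampleBound d κ ε < n) : mu d n κ ε ≤ 0.485 := by
  rw [mu_eq hκ.le hL]
  unfold sampleBound at hn
  have hS := Real.lt_sqrt_of_sq_lt hn
  have hp : 0 ≤ 1 / (2 * (κ + 2 * √κ)) := by positivity
  set a := √(2 * (κ + 2 * √κ) * level d ε)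
  have ha : 0 ≤ a := Real.sqrt_nonneg _
  have hb : 0 ≤ (√κ + 1) * √((d : ℝ) + 1) := by positivity
  have h2 : √2 ≤ 1.415 := Real.sqrt_le_iff.mpr ⟨by norm_num, by norm_num⟩
  have hpa : 0 ≤ 1 / (2 * (κ + 2 * √κ)) * a := mul_nonneg hp ha
  have hn0 : 0 < √(n : ℝ) := by nlinarith
  have e : a / √n + 6.81 * √2 * ((√κ + 1) * (√((d : ℝ) + 1) / √n)) =
      (a + 6.81 * √2 * ((√κ + 1) * √((d : ℝ) + 1))) / √n := by ring
  rw [e, div_le_iff₀ hn0]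
  have h3 : 6.81 * √2 * ((√κ + 1) * √((d : ℝ) + 1)) ≤
      6.81 * 1.415 * ((√κ + 1) * √((d : ℝ) + 1)) := by gcongr
  linarith

theorem sample_size_pos {d n : ℕ} {κ ε : ℝ} (hn : sampleBound d κ ε < n) : 0 < (n : ℝ) :=
  (sq_nonneg _).trans_lt hn

theorem mu_pos {d n : ℕ} {κ ε : ℝ} (hn : 0 < (n : ℝ)) : 0 < mu d n κ ε := by
  unfold mu
  positivity

theorem deltaHat_pos {d n : ℕ} {κ ε : ℝ} (hκ : 0 < κ) (hL : 0 ≤ level d ε)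
    (hn : sampleBound d κ ε < n) : 0 < deltaHat d n κ ε := by
  have := mu_le hκ hL hn
  exact div_pos (mu_pos (sample_size_pos hn)) (by linarith)

theorem gammaMinus_nonneg {d n : ℕ} {κ ε : ℝ} (hκ : 0 < κ) (hL : 0 ≤ level d ε) :
    0 ≤ gammaMinus d n κ ε := by
  unfold gammaMinus
  positivity

/-- The tuning parameters of the deviation bounds. -/
theorem exists_tuning {d n : ℕ} {κ ε : ℝ} (hκ : 1 ≤ κ) (hε : 0 < ε) (hε1 : ε ≤ 1)
    (hn : 0 < (n : ℝ)) :
    ∃ l q : ℝ, 0 < l ∧ 0 < q ∧ l * (κ + 2 * √κ) + 9.6 * q ≤ mu d n κ ε ∧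
      gammaMinus d n κ ε = l ^ 2 / 3 ∧ level d ε = n * l ^ 2 * (κ + 2 * √κ) / 2 ∧
      n * q ^ 2 = (κ + 2 * √κ + 1) * ((d : ℝ) + 1) ∧ 9 * ((d : ℝ) + 1) ≤ 8 * l * n * q := by
  have hM := three_le_add_two_mul_sqrt hκ
  have hL := level_ge (d := d) hε hε1
  have hd : (0 : ℝ) < (d : ℝ) + 1 := by positivity
  have hL0 : 0 < level d ε := lt_of_lt_of_le (by positivity) hL
  have hκ0 : 0 ≤ κ := by linarith
  have hsq := Real.sq_sqrt hκ0
  have hsn : 0 < √(n : ℝ) := Real.sqrt_pos.mpr hn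
  have hsn2 := Real.sq_sqrt hn.le
  have hsd2 := Real.sq_sqrt hd.le
  set M := κ + 2 * √κ with hMdef
  have hM0 : 0 < M := by linarith
  -- This `l` minimizes `l M / 2 + L / (n l)`, the variance term plus the confidence term.
  set l := √(2 * level d ε / (M * n)) with hl
  have hl0 : 0 < l := Real.sqrt_pos.mpr (by positivity)
  have hl2 : l ^ 2 = 2 * level d ε / (M * n) := Real.sq_sqrt (by positivity)
  -- Since `M + 1 = (√κ + 1)²`, the choice `β = 8 l n q` makes the entropy `β/2 = 4 l n q`, and the
  -- dimension term `l²(M + 1)(d + 1)/β` equal to `l q / 8`.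
  set q := (√κ + 1) * (√((d : ℝ) + 1) / √n) with hq
  have hq0 : 0 < q := by positivity
  have hq2 : n * q ^ 2 = (M + 1) * ((d : ℝ) + 1) := by
    rw [hq, mul_pow, div_pow, hsn2, hsd2, hMdef]
    field_simp
    nlinarith
  refine ⟨l, q, hl0, hq0, ?_, ?_, ?_, hq2, ?_⟩
  · rw [mu_eq hκ0 hL0.le, ← hMdef, ← hq]
    have h1 : l * M = √(2 * M * level d ε) / √n := by
      rw [← Real.sqrt_div (by positivity), eq_comm, Real.sqrt_eq_iff_eq_sq (by positivity)
        (by positivity), mul_pow, hl2]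
      field_simp
    rw [h1]
    have h2 : 1.41 ≤ √2 := Real.le_sqrt_of_sq_le (by norm_num)
    have h3 : 6.81 * 1.41 * q ≤ 6.81 * √2 * q := by gcongr
    linarith
  · rw [hl2]
    unfold gammaMinus
    rw [← hMdef]
    field_simp
  · rw [hl2]
    field_simp
  -- Comparison of squares: `0.73 (d + 1) ≤ L` is what makes `β` large enough, as `128 · 0.73 ≥ 81`.
  · refine abs_le_of_sq_le_sq' ?_ (by positivity) |>.2
    have e : (8 * l * n * q) ^ 2 = 128 * level d ε * ((M + 1) / M) * ((d : ℝ) + 1) := by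
      calc (8 * l * n * q) ^ 2 = 64 * l ^ 2 * n * (n * q ^ 2) := by ring
        _ = _ := by rw [hl2, hq2]; field_simp; ring
    rw [e]
    have h1 : 1 ≤ (M + 1) / M := by rw [le_div_iff₀ hM0]; linarith
    calc (9 * ((d : ℝ) + 1)) ^ 2 ≤ 128 * (0.73 * ((d : ℝ) + 1)) * 1 * ((d : ℝ) + 1) := by
          nlinarith [mul_pos hd hd]
      _ ≤ _ := by gcongr

theorem deltaHat_le {d n : ℕ} {κ ε : ℝ} (hd : 1 ≤ d) (hκ : 1 ≤ κ) (hε : 0 < ε) (hε1 : ε ≤ 1)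
    (hn : sampleBound d κ ε < n) :
    deltaHat d n κ ε ≤ 2000 * √(κ * ((d : ℝ) + Real.log ε⁻¹) / n) := by
  have hn0 := sample_size_pos hn
  have hκ0 : 0 < κ := by linarith
  have hL := level_ge (d := d) hε hε1
  have hL0 : 0 ≤ level d ε := le_trans (by positivity) hL
  have hmu := mu_le hκ0 hL0 hn
  have hmu0 := mu_pos (d := d) (κ := κ) (ε := ε) hn0
  have hd1 : (1 : ℝ) ≤ d := by exact_mod_cast hd
  have hlog := Real.log_nonneg ((one_le_inv₀ hε).mpr hε1)
  have hs1 : 1 ≤ √κ := Real.one_le_sqrt.mpr hκ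
  have hsk : √κ ≤ κ := by nlinarith [Real.sq_sqrt hκ0.le]
  set t := √(κ * ((d : ℝ) + Real.log ε⁻¹) / n) with ht
  have ht0 : 0 ≤ t := Real.sqrt_nonneg _
  have h1 : √(2 * (κ + 2 * √κ) / n * level d ε) ≤ 3 * t := by
    rw [ht, show (3 : ℝ) = √9 by rw [show (9 : ℝ) = 3 ^ 2 by norm_num]; simp,
      ← Real.sqrt_mul (by norm_num)]
    apply Real.sqrt_le_sqrt
    have hlv : level d ε ≤ 3 / 2 * ((d : ℝ) + Real.log ε⁻¹) := by unfold level; linarith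
    calc 2 * (κ + 2 * √κ) / n * level d ε
        ≤ 2 * (κ + 2 * κ) / n * (3 / 2 * ((d : ℝ) + Real.log ε⁻¹)) := by gcongr
      _ = _ := by ring
  have h2 : √(2 * ((d : ℝ) + 1) / n) * √κ ≤ 2 * t := by
    rw [ht, show (2 : ℝ) * √(κ * ((d : ℝ) + Real.log ε⁻¹) / n) =
      √(2 ^ 2 * (κ * ((d : ℝ) + Real.log ε⁻¹) / n)) by
        rw [Real.sqrt_mul (by norm_num), Real.sqrt_sq (by norm_num)],
      ← Real.sqrt_mul (by positivity)]
    apply Real.sqrt_le_sqrt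
    calc 2 * ((d : ℝ) + 1) / n * κ ≤ 2 * (2 * ((d : ℝ) + Real.log ε⁻¹)) / n * κ := by
          gcongr; linarith
      _ = _ := by ring
  -- `3 + 6.81 · 2 · 2 ≤ 31`; dividing by `1 - 2μ ≥ 0.03` stays below `2000`.
  have h3 : mu d n κ ε ≤ 31 * t := by
    unfold mu
    have h0 := Real.sqrt_nonneg (2 * ((d : ℝ) + 1) / n)
    have : 6.81 * (√κ + 1) * √(2 * ((d : ℝ) + 1) / n) ≤
        6.81 * (2 * √κ) * √(2 * ((d : ℝ) + 1) / n) := by gcongr; linarith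
    linarith
  unfold deltaHat
  rw [div_le_iff₀ (by linarith)]
  nlinarith

theorem lower_rate_le {d n : ℕ} {κ ε : ℝ} (hκ : 1 ≤ κ) (hε : 0 < ε) (hε1 : ε ≤ 1)
    (hn : sampleBound d κ ε < n) :
    (deltaHat d n κ ε + gammaMinus d n κ ε) / (1 + deltaHat d n κ ε) ≤
      2 * deltaHat d n κ ε := by
  have hn0 := sample_size_pos hn
  have hL := level_ge (d := d) hε hε1
  have hL0 : 0 ≤ level d ε := le_trans (by positivity) hL
  have hmu := mu_le (by linarith) hL0 hn
  have hmu0 := mu_pos (d := d) (κ := κ) (ε := ε) hn0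
  have hδ := deltaHat_pos (by linarith) hL0 hn
  obtain ⟨l, q, hl, hq, h1, h2, -⟩ := exists_tuning (d := d) hκ hε hε1 hn0
  have hM := three_le_add_two_mul_sqrt hκ
  have hg : gammaMinus d n κ ε ≤ deltaHat d n κ ε := by
    rw [h2]
    have hlμ : l ≤ mu d n κ ε := by nlinarith
    unfold deltaHat
    rw [le_div_iff₀ (by linarith)]
    nlinarith [sq_nonneg l]
  rw [div_le_iff₀ (by linarith)]
  nlinarith

theorem gammaMinus_le_one {d n : ℕ} {κ ε : ℝ} (hκ : 1 ≤ κ) (hε : 0 < ε) (hε1 : ε ≤ 1)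
    (hn : sampleBound d κ ε < n) : gammaMinus d n κ ε ≤ 1 := by
  have hn0 := sample_size_pos hn
  have hL0 : 0 ≤ level d ε := le_trans (by positivity) (level_ge (d := d) hε hε1)
  have hmu := mu_le (by linarith) hL0 hn
  obtain ⟨l, q, hl, hq, h1, h2, -⟩ := exists_tuning (d := d) hκ hε hε1 hn0
  have hM := three_le_add_two_mul_sqrt hκ
  rw [h2]
  nlinarith

end Parameters

/-! ### Two-sided bounds for the empirical Gram matrix -/

section Gram

variable {E : Type*} [NormedAddCommGroup E] [InnerProductSpace ℝ E] [FiniteDimensional ℝ E]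
  [MeasurableSpace E] [BorelSpace E] {ρ : Measure E} [IsProbabilityMeasure ρ]
  {Ω : Type*} [MeasurableSpace Ω] {P : Measure Ω} [IsProbabilityMeasure P]
  {d n : ℕ} {V : Fin n → Ω → E} {κ ε : ℝ}

theorem exp_neg_mul_le {l K X : ℝ} (hl : 0 ≤ l) (hX : 0 ≤ X) (hK : 1 ≤ K) :
    Real.exp (-l) * (1 + l + l ^ 2 * K / 2 + X) ≤ 1 + l ^ 2 * (K - 1) / 2 + X := by
  have h1 := Real.quadratic_le_exp_of_nonneg hl
  have h2 : Real.exp (-l) ≤ 1 := Real.exp_le_one_iff.mpr (by linarith)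
  have h3 : Real.exp (-l) * Real.exp l = 1 := by rw [← Real.exp_add]; simp
  have h4 : Real.exp (-l) * (1 + l + l ^ 2 / 2) ≤ 1 := by
    exact (mul_le_mul_of_nonneg_left h1 (Real.exp_pos _).le).trans_eq h3
  have h5 : 0 ≤ l ^ 2 * (K - 1) / 2 + X :=
    add_nonneg (div_nonneg (mul_nonneg (sq_nonneg _) (by linarith)) (by norm_num)) hX
  nlinarith

/-- The cubic remainder of `exp l (1 - l + l²/2)` is the source of `γ₋`: after division by `l` it
becomes `l²/3`. Unlike `exp(-l)`, the factor `exp l` exceeds `1` and inflates the other terms. -/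
theorem exp_mul_le {l K X : ℝ} (hl : 0 ≤ l) (hl1 : l ≤ 1 / 6) (hX : 0 ≤ X) (hK : 1 ≤ K) :
    Real.exp l * (1 - l + l ^ 2 * K / 2 + X) ≤
      1 + l ^ 3 / 3 + (1 + 7 / 6 * l) * (l ^ 2 * (K - 1) / 2) + 6 / 5 * X := by
  have h1 : Real.exp l ≤ 1 + 7 / 6 * l := by
    have := exp_le_one_add_add_sq (x := l) (by rw [abs_of_nonneg hl]; linarith)
    nlinarith
  have h2 : 1 - l + l ^ 2 / 2 ≤ Real.exp (-l) + 2 / 9 * l ^ 3 := by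
    have h := Real.exp_bound (x := -l) (by rw [abs_neg, abs_of_nonneg hl]; linarith) (n := 3)
      (by norm_num)
    rw [abs_neg, abs_of_nonneg hl] at h
    have h' := (abs_le.mp h).1
    norm_num [Finset.sum_range_succ, Nat.factorial] at h'
    linarith
  have h3 : Real.exp l * Real.exp (-l) = 1 := by rw [← Real.exp_add]; simp
  have hl3 : 0 ≤ l ^ 3 := by positivity
  have h4 : Real.exp l * (1 - l + l ^ 2 / 2) ≤ 1 + l ^ 3 / 3 := by
    calc Real.exp l * (1 - l + l ^ 2 / 2)
        ≤ Real.exp l * (Real.exp (-l) + 2 / 9 * l ^ 3) := by gcongr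
      _ = 1 + Real.exp l * (2 / 9 * l ^ 3) := by rw [mul_add, h3]
      _ ≤ 1 + (6 / 5) * (2 / 9 * l ^ 3) := by gcongr; linarith
      _ ≤ _ := by linarith
  have h5 : Real.exp l * (l ^ 2 * (K - 1) / 2) ≤ (1 + 7 / 6 * l) * (l ^ 2 * (K - 1) / 2) := by
    have : 0 ≤ K - 1 := by linarith
    gcongr
  have h6 : Real.exp l * X ≤ 6 / 5 * X := by gcongr; linarith
  calc Real.exp l * (1 - l + l ^ 2 * K / 2 + X) = Real.exp l * (1 - l + l ^ 2 / 2) +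
        Real.exp l * (l ^ 2 * (K - 1) / 2) + Real.exp l * X := by ring
    _ ≤ _ := by linarith

/-- Uniform upper bound for the empirical Gram matrix. -/
theorem gram_upper (hfin : Module.finrank ℝ E = d + 1)
    (hV : ∀ i, Measurable (V i)) (hind : iIndepFun V P)
    (hlaw : ∀ i, P.map (V i) = ρ) (hi : Integrable (fun v : E => ‖v‖ ^ 4) ρ)
    (hK : ∀ θ : E, ‖θ‖ = 1 → ∫ v, (inner ℝ θ v : ℝ) ^ 4 ∂ρ ≤ κ + 2 * √κ + 1)
    (h2 : ∀ θ : E, ‖θ‖ = 1 → ∫ v, (inner ℝ θ v : ℝ) ^ 2 ∂ρ ≤ 1)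
    (hκ : 1 ≤ κ) (hε : 0 < ε) (hε1 : ε ≤ 1) (hn : sampleBound d κ ε < n) :
    ∃ A : Set Ω, MeasurableSet A ∧ P Aᶜ ≤ ENNReal.ofReal ε ∧ ∀ ω ∈ A, ∀ (θ : E) (R : ℝ),
      (∀ i, ‖V i ω‖ ≤ R) → 0 < 1 - deltaHat d n κ ε → 0 < 1 - gammaPlus d n κ ε R →
      (∑ i, (inner ℝ θ (V i ω)) ^ 2) *
        ((1 - deltaHat d n κ ε) * (1 - gammaPlus d n κ ε R)) ≤ n * ‖θ‖ ^ 2 := by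
  have hn0 := sample_size_pos hn
  have hL0 : 0 ≤ level d ε := le_trans (by positivity) (level_ge (d := d) hε hε1)
  have hmu := mu_le (by linarith) hL0 hn
  have hmu0 := mu_pos (d := d) (κ := κ) (ε := ε) hn0
  have hδ := deltaHat_pos (by linarith) hL0 hn
  have hM := three_le_add_two_mul_sqrt hκ
  obtain ⟨l, q, hl, hq, hμ, hγ, hLl, hq2, hβ⟩ := exists_tuning (d := d) hκ hε hε1 hn0
  have hd : (1 : ℝ) ≤ (d : ℝ) + 1 := by linarith [Nat.cast_nonneg (α := ℝ) d]
  obtain ⟨A, hA, hPA, hAb⟩ := upper_quadratic_deviation (β := 8 * l * n * q) hV hind hlaw hi hK h2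
    hl (by linarith) (by rw [hfin]; push_cast; linarith) (by linarith) hε
  refine ⟨A, hA, hPA, fun ω hω θ R hR hδ1 hγ1 => ?_⟩
  have hX : l ^ 2 * (κ + 2 * √κ + 1) * (Module.finrank ℝ E : ℝ) / (8 * l * n * q) = l * q / 8 := by
    rw [hfin]
    push_cast
    rw [mul_assoc, ← hq2]
    field_simp
  have hlog : Real.log ε⁻¹ ≤ n * l ^ 2 * (κ + 2 * √κ) / 2 := by
    rw [← hLl]; unfold level; linarith
  have hunit : ∀ θ : E, ‖θ‖ = 1 →
      ∑ i, upperWeight (l * ‖V i ω‖ ^ 2) * (inner ℝ θ (V i ω)) ^ 2 ≤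
        n * (1 + mu d n κ ε) := by
    intro θ hθ
    have h := hAb ω hω θ hθ
    rw [hX, ← Finset.mul_sum, Finset.sum_sub_distrib] at h
    have he := exp_neg_mul_le (l := l) (K := κ + 2 * √κ + 1) (X := 7 * (l * q / 8)) hl.le
      (by positivity) (by linarith)
    have h3 := mul_le_mul_of_nonneg_left he hn0.le
    simp only [Finset.sum_const, Finset.card_univ, Fintype.card_fin, nsmul_eq_mul, mul_one] at h
    have h4 : l * (∑ i, upperWeight (l * ‖V i ω‖ ^ 2) * (inner ℝ θ (V i ω)) ^ 2 - n) ≤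
        l * (n * mu d n κ ε) := by
      have h5 : l * n * (l * (κ + 2 * √κ) + 9.6 * q) ≤ l * n * mu d n κ ε := by gcongr
      have h6 : 0 ≤ l * n * q := by positivity
      linarith
    have h7 := le_of_mul_le_mul_left h4 hl
    linarith
  have hhom : ∑ i, upperWeight (l * ‖V i ω‖ ^ 2) * (inner ℝ θ (V i ω)) ^ 2 ≤
      n * (1 + mu d n κ ε) * ‖θ‖ ^ 2 := by
    by_cases hθ : θ = 0
    · simp [hθ]
    · have hnθ : 0 < ‖θ‖ := norm_pos_iff.mpr hθ
      have h := hunit (‖θ‖⁻¹ • θ) (norm_smul_inv_norm (𝕜 := ℝ) hθ)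
      simp only [real_inner_smul_left, mul_pow] at h
      calc ∑ i, upperWeight (l * ‖V i ω‖ ^ 2) * (inner ℝ θ (V i ω)) ^ 2
          = (∑ i, upperWeight (l * ‖V i ω‖ ^ 2) * (‖θ‖⁻¹ ^ 2 * (inner ℝ θ (V i ω)) ^ 2)) *
              ‖θ‖ ^ 2 := by
            rw [Finset.sum_mul]
            refine Finset.sum_congr rfl fun i _ => ?_
            field_simp
        _ ≤ _ := by gcongr
  -- `γ₊` is at least `l² R⁴ / 3`; its factor `(1 + δ̂)²` is only slack here.
  have hw : ∀ i, 1 - gammaPlus d n κ ε R ≤ upperWeight (l * ‖V i ω‖ ^ 2) := by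
    intro i
    refine le_trans ?_ (le_max_left _ _)
    unfold gammaPlus
    rw [hγ]
    have h1 : (l * ‖V i ω‖ ^ 2) ^ 2 ≤ l ^ 2 * R ^ 4 := by
      calc (l * ‖V i ω‖ ^ 2) ^ 2 = l ^ 2 * ‖V i ω‖ ^ 4 := by ring
        _ ≤ _ := by gcongr; exact hR i
    have h2 : l ^ 2 / 3 * R ^ 4 * 1 ≤ l ^ 2 / 3 * R ^ 4 * (1 + deltaHat d n κ ε) ^ 2 := by
      have : 0 ≤ R ^ 4 := by positivity
      gcongr
      nlinarith
    linarith
  have hsum : (1 - gammaPlus d n κ ε R) * ∑ i, (inner ℝ θ (V i ω)) ^ 2 ≤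
      n * (1 + mu d n κ ε) * ‖θ‖ ^ 2 := by
    refine le_trans ?_ hhom
    rw [Finset.mul_sum]
    exact Finset.sum_le_sum fun i _ => mul_le_mul_of_nonneg_right (hw i) (sq_nonneg _)
  have hprod : (1 + mu d n κ ε) * (1 - deltaHat d n κ ε) ≤ 1 := by
    have : mu d n κ ε ≤ deltaHat d n κ ε := by
      unfold deltaHat
      rw [le_div_iff₀ (by linarith)]
      nlinarith
    nlinarith
  calc _ = ((1 - gammaPlus d n κ ε R) * ∑ i, (inner ℝ θ (V i ω)) ^ 2) *
        (1 - deltaHat d n κ ε) := by ring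
    _ ≤ (n * (1 + mu d n κ ε) * ‖θ‖ ^ 2) * (1 - deltaHat d n κ ε) := by gcongr
    _ = n * ‖θ‖ ^ 2 * ((1 + mu d n κ ε) * (1 - deltaHat d n κ ε)) := by ring
    _ ≤ n * ‖θ‖ ^ 2 * 1 := by gcongr
    _ = _ := mul_one _

/-- Uniform lower bound for the empirical Gram matrix. -/
theorem gram_lower (hfin : Module.finrank ℝ E = d + 1)
    (hV : ∀ i, Measurable (V i)) (hind : iIndepFun V P)
    (hlaw : ∀ i, P.map (V i) = ρ) (hi : Integrable (fun v : E => ‖v‖ ^ 4) ρ)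
    (hK : ∀ θ : E, ‖θ‖ = 1 → ∫ v, (inner ℝ θ v : ℝ) ^ 4 ∂ρ ≤ κ + 2 * √κ + 1)
    (hκ : 1 ≤ κ) (hε : 0 < ε) (hε1 : ε ≤ 1) (hn : sampleBound d κ ε < n) :
    ∃ A : Set Ω, MeasurableSet A ∧ P Aᶜ ≤ ENNReal.ofReal ε ∧ ∀ ω ∈ A, ∀ θ : E,
      ∫ v, (inner ℝ θ v : ℝ) ^ 2 ∂ρ = ‖θ‖ ^ 2 →
      n * ‖θ‖ ^ 2 * (1 - (deltaHat d n κ ε + gammaMinus d n κ ε) / (1 + deltaHat d n κ ε)) ≤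
        ∑ i, (inner ℝ θ (V i ω)) ^ 2 := by
  have hn0 := sample_size_pos hn
  have hL0 : 0 ≤ level d ε := le_trans (by positivity) (level_ge (d := d) hε hε1)
  have hmu := mu_le (by linarith) hL0 hn
  have hmu0 := mu_pos (d := d) (κ := κ) (ε := ε) hn0
  have hδ := deltaHat_pos (by linarith) hL0 hn
  have hM := three_le_add_two_mul_sqrt hκ
  obtain ⟨l, q, hl, hq, hμ, hγ, hLl, hq2, hβ⟩ := exists_tuning (d := d) hκ hε hε1 hn0
  have hd : (1 : ℝ) ≤ (d : ℝ) + 1 := by linarith [Nat.cast_nonneg (α := ℝ) d]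
  have hlM : l * 3 ≤ l * (κ + 2 * √κ) := by gcongr
  have hlμ : 3 * l ≤ mu d n κ ε := by linarith
  obtain ⟨A, hA, hPA, hAb⟩ := lower_quadratic_deviation (β := 8 * l * n * q) hV hind hlaw hi hK
    hl (by linarith) (by rw [hfin]; push_cast; linarith) (by linarith) hε
  refine ⟨A, hA, hPA, fun ω hω θ hθ2 => ?_⟩
  have hX : l ^ 2 * (κ + 2 * √κ + 1) * (Module.finrank ℝ E : ℝ) / (8 * l * n * q) = l * q / 8 := by
    rw [hfin]
    push_cast
    rw [mul_assoc, ← hq2]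
    field_simp
  have hlog : Real.log ε⁻¹ ≤ n * l ^ 2 * (κ + 2 * √κ) / 2 := by
    rw [← hLl]; unfold level; linarith
  -- With `δ̂ = μ/(1 - 2μ)` the quotient is `(μ + γ₋(1 - 2μ))/(1 - μ)`. Its excess over `μ` is of
  -- order `μ²` and pays for the `7/36 μ²` lost through `exp l`.
  have hfrac : 1 - (deltaHat d n κ ε + gammaMinus d n κ ε) / (1 + deltaHat d n κ ε) ≤
      1 - (l ^ 2 / 3 + mu d n κ ε + 7 / 36 * mu d n κ ε ^ 2) := by
    rw [hγ]
    unfold deltaHat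
    set m := mu d n κ ε
    have h1 : 0 < 1 - 2 * m := by linarith
    have h2 : 0 < 1 - m := by linarith
    have e : (m / (1 - 2 * m) + l ^ 2 / 3) / (1 + m / (1 - 2 * m)) =
        (m + l ^ 2 / 3 * (1 - 2 * m)) / (1 - m) := by
      have h3 : 1 - 2 * m ≠ 0 := h1.ne'
      have h4 : 1 + m / (1 - 2 * m) = (1 - m) / (1 - 2 * m) := by
        rw [eq_div_iff h3, add_mul, div_mul_cancel₀ _ h3]; ring
      have h5 : m / (1 - 2 * m) + l ^ 2 / 3 =
          (m + l ^ 2 / 3 * (1 - 2 * m)) / (1 - 2 * m) := by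
        rw [eq_div_iff h3, add_mul, div_mul_cancel₀ _ h3]
      rw [h4, h5, div_div_div_cancel_right₀ h3]
    rw [e]
    have : l ^ 2 / 3 + m + 7 / 36 * m ^ 2 ≤ (m + l ^ 2 / 3 * (1 - 2 * m)) / (1 - m) := by
      rw [le_div_iff₀ h2]
      have hl2 : l ^ 2 ≤ (m / 3) ^ 2 := by gcongr; linarith
      have hs : 0 ≤ m * (29 / 36 * m + 7 / 36 * m ^ 2 - l ^ 2 / 3) := by
        refine mul_nonneg hmu0.le ?_
        nlinarith
      nlinarith
    linarith
  have hunit : ∀ θ : E, ‖θ‖ = 1 → ∫ v, (inner ℝ θ v : ℝ) ^ 2 ∂ρ = 1 →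
      n * (1 - (deltaHat d n κ ε + gammaMinus d n κ ε) / (1 + deltaHat d n κ ε)) ≤
        ∑ i, (inner ℝ θ (V i ω)) ^ 2 := by
    intro θ hθ hθ2
    have h := hAb ω hω θ hθ hθ2
    rw [hX, ← Finset.mul_sum, Finset.sum_sub_distrib] at h
    have he := exp_mul_le (l := l) (K := κ + 2 * √κ + 1) (X := 4 * (l * q / 8)) hl.le
      (by linarith) (by positivity) (by linarith)
    have h3 := mul_le_mul_of_nonneg_left he hn0.le
    simp only [Finset.sum_const, Finset.card_univ, Fintype.card_fin, nsmul_eq_mul, mul_one] at h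
    have h4 : l * (n - ∑ i, (inner ℝ θ (V i ω)) ^ 2) ≤
        l * (n * (l ^ 2 / 3 + mu d n κ ε + 7 / 36 * mu d n κ ε ^ 2)) := by
      have h5 : l * n * (l * (κ + 2 * √κ) + 9.6 * q) ≤ l * n * mu d n κ ε := by gcongr
      have h6 : 0 ≤ l * n * q := by positivity
      -- `l ≤ μ/3` and `l M ≤ μ`; with the factor `7/12` this yields `7/36 μ²`.
      have h7 : l * n * (l * (l * (κ + 2 * √κ))) ≤
          l * n * (mu d n κ ε / 3 * mu d n κ ε) := by
        gcongr
        · linarith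
        · linarith
      linarith
    have h7 := le_of_mul_le_mul_left h4 hl
    have h8 := mul_le_mul_of_nonneg_left hfrac hn0.le
    linarith
  by_cases hθ : θ = 0
  · simp [hθ]
  · have hnθ : 0 < ‖θ‖ := norm_pos_iff.mpr hθ
    have h := hunit (‖θ‖⁻¹ • θ) (norm_smul_inv_norm (𝕜 := ℝ) hθ) (by
      simp only [real_inner_smul_left, mul_pow]
      rw [integral_const_mul, hθ2]
      field_simp)
    simp only [real_inner_smul_left, mul_pow] at h
    calc n * ‖θ‖ ^ 2 * (1 - (deltaHat d n κ ε + gammaMinus d n κ ε) / (1 + deltaHat d n κ ε))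
        = n * (1 - (deltaHat d n κ ε + gammaMinus d n κ ε) / (1 + deltaHat d n κ ε)) *
            ‖θ‖ ^ 2 := by ring
      _ ≤ (∑ i, ‖θ‖⁻¹ ^ 2 * (inner ℝ θ (V i ω)) ^ 2) * ‖θ‖ ^ 2 := by gcongr
      _ = _ := by
          rw [Finset.sum_mul]
          refine Finset.sum_congr rfl fun i _ => ?_
          field_simp

end Gram

/-! ### Quadratic forms of the covariance matrices -/

section QuadraticForms

variable {d : ℕ}

theorem inner_eq_dotProduct (x y : Vec d) : (inner ℝ x y : ℝ) = x.ofLp ⬝ᵥ y.ofLp := by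
  rw [EuclideanSpace.inner_eq_star_dotProduct, dotProduct_comm]
  simp

theorem quadForm_vecMulVec (x θ : Vec d) :
    quadForm (Matrix.vecMulVec x.ofLp x.ofLp) θ = (inner ℝ θ x : ℝ) ^ 2 := by
  rw [quadForm, inner_eq_dotProduct, Matrix.vecMulVec_mulVec, dotProduct_smul,
    dotProduct_comm x.ofLp θ.ofLp]
  simp
  ring

/-- Pairwise differences ignore the centre `m`, so it may be the true mean. The right side is a sum
of squares of one affine function `c + ⟨θ, · - m⟩`, the kind that the whitened vectors represent. -/
theorem quadForm_empCovMatrix {n : ℕ} (hn : 0 < (n : ℝ)) (x : Fin n → Vec d) (m θ : Vec d) :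
    n * quadForm (empCovMatrix x) θ =
      ∑ i, ((inner ℝ θ (x i - m) : ℝ) - (∑ j, (inner ℝ θ (x j - m) : ℝ)) / n) ^ 2 := by
  have h1 : quadForm (empCovMatrix x) θ =
      (1 / (2 * (n : ℝ) ^ 2)) * ∑ i, ∑ j, (inner ℝ θ (x i - x j) : ℝ) ^ 2 := by
    simp only [← quadForm_vecMulVec]
    simp only [quadForm, empCovMatrix, Matrix.smul_mulVec, Matrix.sum_mulVec, dotProduct_smul,
      dotProduct_sum, smul_eq_mul]
  set y : Fin n → ℝ := fun i => inner ℝ θ (x i - m)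
  have h2 : ∀ i j, (inner ℝ θ (x i - x j) : ℝ) = y i - y j := by
    intro i j
    rw [← inner_sub_right]
    congr 1
    abel
  rw [h1]
  simp only [h2, sub_sq, Finset.sum_add_distrib, Finset.sum_sub_distrib, Finset.sum_const,
    Finset.card_univ, Fintype.card_fin, nsmul_eq_mul, ← Finset.mul_sum, ← Finset.sum_mul]
  field_simp
  ring

theorem quadForm_empCovMatrix_le {n : ℕ} (hn : 0 < (n : ℝ)) (x : Fin n → Vec d) (m θ : Vec d) :
    n * quadForm (empCovMatrix x) θ ≤ ∑ i, (inner ℝ θ (x i - m) : ℝ) ^ 2 := by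
  rw [quadForm_empCovMatrix hn x m θ]
  set y : Fin n → ℝ := fun i => inner ℝ θ (x i - m)
  have h : ∑ i, (y i - (∑ j, y j) / n) ^ 2 = ∑ i, y i ^ 2 - (∑ j, y j) ^ 2 / n := by
    simp only [sub_sq, Finset.sum_add_distrib, Finset.sum_sub_distrib, Finset.sum_const,
      Finset.card_univ, Fintype.card_fin, nsmul_eq_mul, ← Finset.mul_sum, ← Finset.sum_mul]
    field_simp
    ring
  rw [h]
  have : 0 ≤ (∑ j, y j) ^ 2 / n := by positivity
  linarith

theorem quadForm_empCovMatrix_nonneg {n : ℕ} (hn : 0 < (n : ℝ)) (x : Fin n → Vec d) (θ : Vec d) :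
    0 ≤ quadForm (empCovMatrix x) θ := by
  have h : 0 ≤ n * quadForm (empCovMatrix x) θ := by
    rw [quadForm_empCovMatrix hn x 0 θ]
    positivity
  exact nonneg_of_mul_nonneg_right h hn

theorem quadForm_eq_sum_eigenvalues {A : Matrix (Fin d) (Fin d) ℝ} (hA : A.IsHermitian)
    (θ : Vec d) :
    quadForm A θ = ∑ i, hA.eigenvalues i * (inner ℝ (hA.eigenvectorBasis i) θ : ℝ) ^ 2 := by
  have hT : A.transpose = A := by
    rw [← Matrix.conjTranspose_eq_transpose_of_trivial]; exact hA
  have h1 : quadForm A θ = inner ℝ θ (WithLp.toLp 2 (A.mulVec θ.ofLp)) := by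
    rw [inner_eq_dotProduct]; rfl
  rw [h1, ← hA.eigenvectorBasis.sum_inner_mul_inner]
  refine Finset.sum_congr rfl fun i _ => ?_
  have h2 : (inner ℝ (hA.eigenvectorBasis i) (WithLp.toLp 2 (A.mulVec θ.ofLp)) : ℝ) =
      hA.eigenvalues i * inner ℝ (hA.eigenvectorBasis i) θ := by
    rw [inner_eq_dotProduct, inner_eq_dotProduct]
    simp only
    rw [Matrix.dotProduct_mulVec, ← Matrix.mulVec_transpose, hT, hA.mulVec_eigenvectorBasis]
    simp [smul_dotProduct]
  rw [h2, real_inner_comm]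
  ring

/-- The diagonal coefficients of the generalized inverse square root. -/
noncomputable def invSqrtCoeff {A : Matrix (Fin d) (Fin d) ℝ} (hA : A.IsHermitian) (i : Fin d) :
    ℝ :=
  if 0 < hA.eigenvalues i then 1 / √(hA.eigenvalues i) else 0

theorem norm_invSqrt_mulVec_sq {A : Matrix (Fin d) (Fin d) ℝ} (hA : A.IsHermitian) (z : Vec d) :
    ‖WithLp.toLp 2 ((invSqrt hA).mulVec z.ofLp)‖ ^ 2 =
      ∑ i, (invSqrtCoeff hA i * (inner ℝ (hA.eigenvectorBasis i) z : ℝ)) ^ 2 := by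
  set U : Matrix (Fin d) (Fin d) ℝ := (hA.eigenvectorUnitary : Matrix (Fin d) (Fin d) ℝ) with hU
  have hUU : U.transpose * U = 1 := by
    have := (Matrix.mem_unitaryGroup_iff'.mp hA.eigenvectorUnitary.2)
    rw [Matrix.star_eq_conjTranspose] at this
    simpa [Matrix.conjTranspose_eq_transpose_of_trivial] using this
  set y : Fin d → ℝ := fun i => invSqrtCoeff hA i * (inner ℝ (hA.eigenvectorBasis i) z : ℝ) with hy
  have h1 : (invSqrt hA).mulVec z.ofLp = U.mulVec y := by
    unfold invSqrt
    rw [← hU, ← Matrix.mulVec_mulVec, ← Matrix.mulVec_mulVec]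
    congr 1
    ext i
    rw [Matrix.mulVec_diagonal, hy]
    simp only [invSqrtCoeff]
    congr 1
    rw [inner_eq_dotProduct]
    rfl
  rw [h1, ← real_inner_self_eq_norm_sq, inner_eq_dotProduct]
  simp only
  rw [Matrix.dotProduct_mulVec, ← Matrix.mulVec_transpose, Matrix.mulVec_mulVec, hUU,
    Matrix.one_mulVec]
  simp [dotProduct, sq, hy]

end QuadraticForms

/-! ### Moments of affine functions of the vector -/

section MomentsOfMarginals

variable {d : ℕ} {Ω : Type*} [MeasurableSpace Ω] {P : Measure Ω} [IsProbabilityMeasure P]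
  {X : Ω → Vec d}

theorem memLp_inner_centered (hX : MemLp X 2 P) (θ : Vec d) :
    MemLp (fun ω => (inner ℝ θ (X ω - ∫ ω', X ω' ∂P) : ℝ)) 2 P :=
  (innerSL ℝ θ).comp_memLp' (hX.sub (memLp_const _))

theorem integral_inner_centered (hX : MemLp X 2 P) (θ : Vec d) :
    ∫ ω, (inner ℝ θ (X ω - ∫ ω', X ω' ∂P) : ℝ) ∂P = 0 := by
  have hi : Integrable X P := hX.integrable (by norm_num)
  have h := integral_inner (𝕜 := ℝ) (f := fun ω => X ω - ∫ ω', X ω' ∂P)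
    (hi.sub (integrable_const _)) θ
  rw [integral_sub hi (integrable_const _)] at h
  simpa using h

theorem quadForm_covMatrix (hX : MemLp X 2 P) (θ : Vec d) :
    quadForm (covMatrix P X) θ = ∫ ω, (inner ℝ θ (X ω - ∫ ω', X ω' ∂P) : ℝ) ^ 2 ∂P := by
  set Z : Ω → Vec d := fun ω => X ω - ∫ ω', X ω' ∂P with hZ
  have hZ2 : ∀ j, MemLp (fun ω => Z ω j) 2 P := by
    intro j
    have := memLp_inner_centered hX (EuclideanSpace.single j (1 : ℝ))
    simpa [hZ, EuclideanSpace.inner_single_left] using this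
  have hi : ∀ j k, Integrable (fun ω => θ j * (Z ω j * Z ω k * θ k)) P := fun j k =>
    (((hZ2 j).integrable_mul (hZ2 k)).mul_const _).const_mul _
  have e : ∀ ω, (inner ℝ θ (Z ω) : ℝ) ^ 2 = ∑ j, ∑ k, θ j * (Z ω j * Z ω k * θ k) := by
    intro ω
    rw [inner_eq_dotProduct, sq, dotProduct, Finset.sum_mul_sum]
    refine Finset.sum_congr rfl fun j _ => Finset.sum_congr rfl fun k _ => ?_
    ring
  change _ = ∫ ω, (inner ℝ θ (Z ω) : ℝ) ^ 2 ∂P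
  simp only [e]
  rw [integral_finsetSum _ fun j _ => integrable_finsetSum _ fun k _ => hi j k]
  simp only [quadForm, dotProduct, Matrix.mulVec, covMatrix, Matrix.of_apply, Finset.mul_sum]
  refine Finset.sum_congr rfl fun j _ => ?_
  rw [integral_finsetSum _ fun k _ => hi j k]
  refine Finset.sum_congr rfl fun k _ => ?_
  rw [integral_const_mul, integral_mul_const]

/-- Rescale `θ` to unit variance. Finiteness of the `[0, ∞]`-valued supremum supplies integrability;
when the variance is zero, the marginal vanishes almost surely. -/
theorem pow_four_moment_le (hX : MemLp X 2 P) {κ : ℝ} (hκ : 0 < κ)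
    (hk : kurtosis P X ≤ ENNReal.ofReal κ) (θ : Vec d) :
    Integrable (fun ω => (inner ℝ θ (X ω - ∫ ω', X ω' ∂P) : ℝ) ^ 4) P ∧
    ∫ ω, (inner ℝ θ (X ω - ∫ ω', X ω' ∂P) : ℝ) ^ 4 ∂P ≤ κ * quadForm (covMatrix P X) θ ^ 2 := by
  have h2 := memLp_inner_centered hX θ
  rw [quadForm_covMatrix hX θ]
  set s := ∫ ω, (inner ℝ θ (X ω - ∫ ω', X ω' ∂P) : ℝ) ^ 2 ∂P with hs
  have hs0 : 0 ≤ s := integral_nonneg fun ω => sq_nonneg _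
  rcases hs0.eq_or_lt with h0 | hpos
  · have hz : ∀ᵐ ω ∂P, (inner ℝ θ (X ω - ∫ ω', X ω' ∂P) : ℝ) ^ 4 = 0 := by
      have := (integral_eq_zero_iff_of_nonneg (fun ω => sq_nonneg _) h2.integrable_sq).mp h0.symm
      filter_upwards [this] with ω hω
      have : (inner ℝ θ (X ω - ∫ ω', X ω' ∂P) : ℝ) ^ 2 = 0 := hω
      rw [show (4 : ℕ) = 2 * 2 by norm_num, pow_mul, this]
      norm_num
    refine ⟨(integrable_zero _ _ _).congr (hz.mono fun ω hω => hω.symm), ?_⟩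
    rw [integral_congr_ae hz]
    simp
    positivity
  · have hsq := Real.sq_sqrt hs0
    have hsp : 0 < √s := Real.sqrt_pos.mpr hpos
    have hmem : ∫ ω, (inner ℝ ((√s)⁻¹ • θ) (X ω - ∫ ω', X ω' ∂P) : ℝ) ^ 2 ∂P ≤ 1 := by
      simp only [real_inner_smul_left, mul_pow]
      rw [integral_const_mul, ← hs, inv_pow, hsq, inv_mul_cancel₀ hpos.ne']
    have hle : ∫⁻ ω, ENNReal.ofReal ((inner ℝ ((√s)⁻¹ • θ) (X ω - ∫ ω', X ω' ∂P) : ℝ) ^ 4) ∂P ≤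
        ENNReal.ofReal κ := le_trans (le_iSup₂_of_le (f := fun (θ : Vec d)
          (_ : θ ∈ {θ : Vec d | ∫ ω, (inner ℝ θ (X ω - ∫ ω', X ω' ∂P) : ℝ) ^ 2 ∂P ≤ 1}) =>
            ∫⁻ ω, ENNReal.ofReal ((inner ℝ θ (X ω - ∫ ω', X ω' ∂P) : ℝ) ^ 4) ∂P)
          _ hmem le_rfl) hk
    have hm : AEStronglyMeasurable
        (fun ω => (inner ℝ ((√s)⁻¹ • θ) (X ω - ∫ ω', X ω' ∂P) : ℝ) ^ 4) P :=
      (memLp_inner_centered hX ((√s)⁻¹ • θ)).aestronglyMeasurable.pow 4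
    have hnn : ∀ ω, 0 ≤ (inner ℝ ((√s)⁻¹ • θ) (X ω - ∫ ω', X ω' ∂P) : ℝ) ^ 4 := fun ω => by
      positivity
    have hint : Integrable (fun ω => (inner ℝ ((√s)⁻¹ • θ) (X ω - ∫ ω', X ω' ∂P) : ℝ) ^ 4) P := by
      refine ⟨hm, ?_⟩
      rw [hasFiniteIntegral_iff_ofReal (Filter.Eventually.of_forall hnn)]
      exact hle.trans_lt ENNReal.ofReal_lt_top
    have hle' : ∫ ω, (inner ℝ ((√s)⁻¹ • θ) (X ω - ∫ ω', X ω' ∂P) : ℝ) ^ 4 ∂P ≤ κ := by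
      rw [← ofReal_integral_eq_lintegral_ofReal hint (Filter.Eventually.of_forall hnn)] at hle
      exact (ENNReal.ofReal_le_ofReal_iff hκ.le).mp hle
    have e : ∀ ω, (inner ℝ θ (X ω - ∫ ω', X ω' ∂P) : ℝ) ^ 4 =
        s ^ 2 * (inner ℝ ((√s)⁻¹ • θ) (X ω - ∫ ω', X ω' ∂P) : ℝ) ^ 4 := by
      intro ω
      rw [real_inner_smul_left, mul_pow, ← mul_assoc, inv_pow,
        show √s ^ 4 = s ^ 2 by rw [show (4 : ℕ) = 2 * 2 by norm_num, pow_mul, hsq],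
        mul_inv_cancel₀ (by positivity), one_mul]
    simp only [e]
    refine ⟨hint.const_mul _, ?_⟩
    rw [integral_const_mul, mul_comm]
    gcongr

/-- Expand `E(Y² - s)² ≥ 0`, where `s = E Y²`. -/
theorem one_le_of_quadForm_pos (hX : MemLp X 2 P) {κ : ℝ} (hκ : 0 < κ)
    (hk : kurtosis P X ≤ ENNReal.ofReal κ) {θ : Vec d} (hθ : 0 < quadForm (covMatrix P X) θ) :
    1 ≤ κ := by
  obtain ⟨h4, h4le⟩ := pow_four_moment_le hX hκ hk θ
  have h2 := (memLp_inner_centered hX θ).integrable_sq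
  have hs := quadForm_covMatrix hX θ
  set s := quadForm (covMatrix P X) θ
  have h : 0 ≤ ∫ ω, ((inner ℝ θ (X ω - ∫ ω', X ω' ∂P) : ℝ) ^ 4 -
      2 * s * (inner ℝ θ (X ω - ∫ ω', X ω' ∂P) : ℝ) ^ 2 + s ^ 2) ∂P := by
    refine integral_nonneg fun ω => ?_
    have e : (inner ℝ θ (X ω - ∫ ω', X ω' ∂P) : ℝ) ^ 4 -
      2 * s * (inner ℝ θ (X ω - ∫ ω', X ω' ∂P) : ℝ) ^ 2 + s ^ 2 =
      ((inner ℝ θ (X ω - ∫ ω', X ω' ∂P) : ℝ) ^ 2 - s) ^ 2 := by ring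
    simp only [Pi.zero_apply]
    rw [e]
    positivity
  have h4' : Integrable (fun ω => (inner ℝ θ (X ω - ∫ ω', X ω' ∂P) : ℝ) ^ 4 -
      2 * s * (inner ℝ θ (X ω - ∫ ω', X ω' ∂P) : ℝ) ^ 2) P := h4.sub (h2.const_mul _)
  rw [integral_add h4' (integrable_const _), integral_sub h4 (h2.const_mul _),
    integral_const_mul, ← hs] at h
  simp at h
  have : 0 ≤ s ^ 2 * (κ - 1) := by nlinarith
  have := nonneg_of_mul_nonneg_right this (by positivity)
  linarith

/-- The second and fourth moments of `c + y`, for a centered variable `y` with variance `s` and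
fourth moment at most `κ s²`. -/
theorem affine_moments_of_centered {y : Ω → ℝ} {s κ : ℝ} (hκ : 1 ≤ κ) (h1 : Integrable y P)
    (h2 : Integrable (fun ω => y ω ^ 2) P) (h4 : Integrable (fun ω => y ω ^ 4) P)
    (h0 : ∫ ω, y ω ∂P = 0) (hs : ∫ ω, y ω ^ 2 ∂P = s) (h4le : ∫ ω, y ω ^ 4 ∂P ≤ κ * s ^ 2)
    (c : ℝ) :
    ∫ ω, (c + y ω) ^ 2 ∂P = c ^ 2 + s ∧
    ∫ ω, (c + y ω) ^ 4 ∂P ≤ (κ + 2 * √κ + 1) * (c ^ 2 + s) ^ 2 := by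
  have hs0 : 0 ≤ s := hs ▸ integral_nonneg fun ω => sq_nonneg _
  have hr : 1 ≤ √κ := Real.one_le_sqrt.mpr hκ
  have hrr := Real.sq_sqrt (zero_le_one.trans hκ)
  set r := √κ
  have hr0 : 0 < r := by linarith
  constructor
  · have e : ∀ ω, (c + y ω) ^ 2 = c ^ 2 + (2 * c * y ω + y ω ^ 2) := fun ω => by ring
    have j : Integrable (fun ω => 2 * c * y ω + y ω ^ 2) P := (h1.const_mul _).add h2
    simp only [e]
    rw [integral_add (integrable_const _) j,
      integral_add (h1.const_mul _) h2, integral_const_mul, h0, hs]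
    simp
  · have j1 : Integrable (fun ω => (6 * c ^ 2 + 2 * c ^ 2 * r) * y ω ^ 2 +
        (1 + 2 / r) * y ω ^ 4) P := (h2.const_mul _).add (h4.const_mul _)
    have j2 : Integrable (fun ω => 4 * c ^ 3 * y ω + ((6 * c ^ 2 + 2 * c ^ 2 * r) * y ω ^ 2 +
        (1 + 2 / r) * y ω ^ 4)) P := (h1.const_mul _).add j1
    calc ∫ ω, (c + y ω) ^ 4 ∂P ≤ ∫ ω, (c ^ 4 + (4 * c ^ 3 * y ω +
          ((6 * c ^ 2 + 2 * c ^ 2 * r) * y ω ^ 2 + (1 + 2 / r) * y ω ^ 4))) ∂P := by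
          refine integral_mono_of_nonneg (Filter.Eventually.of_forall fun ω => ?_)
            ((integrable_const _).add j2) (Filter.Eventually.of_forall fun ω => ?_)
          · simp only [Pi.zero_apply]; positivity
          · simp only
            -- Absorbs the cubic term, whose sign is unknown: `4cy³ ≤ (2/r)y⁴ + 2c²ry²`. With `r =
            -- √κ` the extra fourth moment is at most `2√κ s²`.
            have h : 0 ≤ 2 / r * y ω ^ 2 * (y ω - c * r) ^ 2 := by positivity
            have e : 2 / r * y ω ^ 2 * (y ω - c * r) ^ 2 =
                2 / r * y ω ^ 4 - 4 * c * y ω ^ 3 + 2 * c ^ 2 * r * y ω ^ 2 := by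
              field_simp; ring
            nlinarith
      _ = c ^ 4 + ((6 * c ^ 2 + 2 * c ^ 2 * r) * s + (1 + 2 / r) * ∫ ω, y ω ^ 4 ∂P) := by
          rw [integral_add (integrable_const _) j2, integral_add (h1.const_mul _) j1,
            integral_add (h2.const_mul _) (h4.const_mul _), integral_const_mul,
            integral_const_mul, integral_const_mul, h0, hs]
          simp
      _ ≤ c ^ 4 + ((6 * c ^ 2 + 2 * c ^ 2 * r) * s + (1 + 2 / r) * (κ * s ^ 2)) := by gcongr
      _ = c ^ 4 + (6 * c ^ 2 + 2 * c ^ 2 * r) * s + κ * s ^ 2 + 2 * r * s ^ 2 := by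
          rw [← hrr]; field_simp; ring
      _ ≤ (κ + 2 * r + 1) * (c ^ 2 + s) ^ 2 := by
          have t1 : 0 ≤ (κ - 1) * (c ^ 2 * s) := mul_nonneg (by linarith) (by positivity)
          have t2 : 0 ≤ (κ - 1) * (c ^ 2) ^ 2 := mul_nonneg (by linarith) (by positivity)
          have t3 : 0 ≤ r * (c ^ 2 * s) := by positivity
          have t4 : 0 ≤ r * (c ^ 2) ^ 2 := by positivity
          nlinarith [sq_nonneg (c ^ 2 - s)]

theorem affine_moments (hX : MemLp X 2 P) {κ : ℝ} (hκ : 1 ≤ κ)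
    (hk : kurtosis P X ≤ ENNReal.ofReal κ) (θ : Vec d) (c : ℝ) :
    ∫ ω, (c + (inner ℝ θ (X ω - ∫ ω', X ω' ∂P) : ℝ)) ^ 2 ∂P =
      c ^ 2 + quadForm (covMatrix P X) θ ∧
    ∫ ω, (c + (inner ℝ θ (X ω - ∫ ω', X ω' ∂P) : ℝ)) ^ 4 ∂P ≤
      (κ + 2 * √κ + 1) * (c ^ 2 + quadForm (covMatrix P X) θ) ^ 2 := by
  obtain ⟨h4, h4le⟩ := pow_four_moment_le hX (zero_lt_one.trans_le hκ) hk θ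
  have hL := memLp_inner_centered hX θ
  exact affine_moments_of_centered hκ (hL.integrable (by norm_num)) hL.integrable_sq h4
    (integral_inner_centered hX θ) (quadForm_covMatrix hX θ).symm h4le c

end MomentsOfMarginals

/-! ### Whitening with a constant coordinate -/

section Whitening

variable {d : ℕ} {A : Matrix (Fin d) (Fin d) ℝ}

/-- The whitened vector `A^{-1/2} (x - m)`, in the eigenbasis of `A`, preceded by the constant
coordinate `1`. -/
noncomputable def whiten (hA : A.IsHermitian) (m x : Vec d) : EuclideanSpace ℝ (Fin (d + 1)) :=
  WithLp.toLp 2 (Fin.cons 1 fun i =>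
    invSqrtCoeff hA i * (inner ℝ (hA.eigenvectorBasis i) (x - m) : ℝ))

/-- The direction of `ℝ^(d+1)` that corresponds to `x ↦ c + ⟨θ, x - m⟩`. -/
noncomputable def whitenDual (hA : A.IsHermitian) (c : ℝ) (θ : Vec d) :
    EuclideanSpace ℝ (Fin (d + 1)) :=
  WithLp.toLp 2 (Fin.cons c fun i =>
    √(hA.eigenvalues i) * (inner ℝ (hA.eigenvectorBasis i) θ : ℝ))

theorem measurable_whiten (hA : A.IsHermitian) (m : Vec d) : Measurable (whiten hA m) := by
  refine (PiLp.continuous_toLp 2 _).measurable.comp (measurable_pi_lambda _ fun j => ?_)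
  refine Fin.cases ?_ (fun i => ?_) j
  · simp
  · simp only [Fin.cons_succ]
    fun_prop

theorem norm_whiten_sq (hA : A.IsHermitian) (m x : Vec d) :
    ‖whiten hA m x‖ ^ 2 = ‖WithLp.toLp 2 ((invSqrt hA).mulVec (x - m).ofLp)‖ ^ 2 + 1 := by
  rw [norm_invSqrt_mulVec_sq hA (x - m), EuclideanSpace.real_norm_sq_eq, Fin.sum_univ_succ]
  simp [whiten, add_comm]

theorem inner_whiten (hA : A.IsHermitian) (m x : Vec d) (τ : EuclideanSpace ℝ (Fin (d + 1))) :
    (inner ℝ τ (whiten hA m x) : ℝ) =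
      τ 0 + inner ℝ (∑ i, (τ (Fin.succ i) * invSqrtCoeff hA i) • hA.eigenvectorBasis i) (x - m) := by
  rw [sum_inner, PiLp.inner_apply, Fin.sum_univ_succ]
  simp only [whiten, Fin.cons_zero, Fin.cons_succ, real_inner_smul_left]
  congr 1
  · simp
  · refine Finset.sum_congr rfl fun i _ => ?_
    simp
    ring

theorem norm_whitenDual_sq (hA : A.IsHermitian) (h0 : ∀ i, 0 ≤ hA.eigenvalues i) (c : ℝ)
    (θ : Vec d) : ‖whitenDual hA c θ‖ ^ 2 = c ^ 2 + quadForm A θ := by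
  rw [quadForm_eq_sum_eigenvalues hA, EuclideanSpace.real_norm_sq_eq, Fin.sum_univ_succ]
  simp only [whitenDual, Fin.cons_zero, Fin.cons_succ]
  congr 1
  refine Finset.sum_congr rfl fun i _ => ?_
  rw [mul_pow, Real.sq_sqrt (h0 i)]

theorem sqrt_mul_invSqrtCoeff (hA : A.IsHermitian) (i : Fin d) :
    √(hA.eigenvalues i) * invSqrtCoeff hA i = if 0 < hA.eigenvalues i then 1 else 0 := by
  unfold invSqrtCoeff
  split_ifs with h
  · have := (Real.sqrt_pos.mpr h).ne'
    field_simp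
  · simp

/-- The factors `√λ` and `λ^{-1/2}` cancel on positive eigenvalues; elsewhere whitening loses the
coordinate, so `x - m` must vanish there. -/
theorem inner_whitenDual_whiten (hA : A.IsHermitian) {m x : Vec d}
    (hx : ∀ i, ¬ 0 < hA.eigenvalues i → (inner ℝ (hA.eigenvectorBasis i) (x - m) : ℝ) = 0)
    (c : ℝ) (θ : Vec d) :
    (inner ℝ (whitenDual hA c θ) (whiten hA m x) : ℝ) = c + inner ℝ θ (x - m) := by
  rw [inner_whiten, sum_inner, ← hA.eigenvectorBasis.sum_inner_mul_inner θ (x - m)]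
  simp only [whitenDual, Fin.cons_zero, Fin.cons_succ, real_inner_smul_left]
  congr 1
  refine Finset.sum_congr rfl fun i _ => ?_
  have h := sqrt_mul_invSqrtCoeff hA i
  by_cases hi : 0 < hA.eigenvalues i
  · rw [if_pos hi] at h
    rw [real_inner_comm (hA.eigenvectorBasis i) θ]
    linear_combination ((inner ℝ (hA.eigenvectorBasis i) θ : ℝ) *
      inner ℝ (hA.eigenvectorBasis i) (x - m)) * h
  · rw [hx i hi, mul_zero, mul_zero]

/-- Only an inequality for general `τ`, since coordinates of `τ` along null eigenvectors contribute
nothing on the left. -/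
theorem quadForm_whiten_adjoint_le (hA : A.IsHermitian) (τ : EuclideanSpace ℝ (Fin (d + 1))) :
    τ 0 ^ 2 + quadForm A (∑ i, (τ (Fin.succ i) * invSqrtCoeff hA i) • hA.eigenvectorBasis i) ≤
      ‖τ‖ ^ 2 := by
  rw [quadForm_eq_sum_eigenvalues hA, EuclideanSpace.real_norm_sq_eq, Fin.sum_univ_succ]
  gcongr with i
  rw [hA.eigenvectorBasis.orthonormal.inner_right_fintype]
  unfold invSqrtCoeff
  split_ifs with h
  · rw [mul_pow, div_pow, Real.sq_sqrt h.le]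
    apply le_of_eq
    field_simp
  · simp
    positivity

theorem inner_eq_zero_of_quadForm_eq_zero (hA : A.IsHermitian)
    (h0 : ∀ i, 0 ≤ hA.eigenvalues i) {m x θ : Vec d}
    (hx : ∀ i, ¬ 0 < hA.eigenvalues i → (inner ℝ (hA.eigenvectorBasis i) (x - m) : ℝ) = 0)
    (hθ : quadForm A θ = 0) : (inner ℝ θ (x - m) : ℝ) = 0 := by
  have h1 := norm_whitenDual_sq hA h0 0 θ
  rw [hθ] at h1
  have h2 : whitenDual hA 0 θ = 0 := by simpa using h1
  have h3 := inner_whitenDual_whiten hA hx 0 θ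
  rw [h2] at h3
  simpa using h3.symm

end Whitening

/-! ### Moments of the whitened vector -/

section CovarianceBounds

variable {d : ℕ} {Ω : Type*} [MeasurableSpace Ω] {P : Measure Ω} [IsProbabilityMeasure P]
  {X : Ω → Vec d}

theorem eigenvalues_covMatrix_nonneg (hX : MemLp X 2 P) (i : Fin d) :
    0 ≤ (covMatrix_isHermitian P X).eigenvalues i := by
  set hA := covMatrix_isHermitian P X
  have h := quadForm_eq_sum_eigenvalues hA (hA.eigenvectorBasis i)
  simp only [hA.eigenvectorBasis.inner_eq_ite] at h
  simp at h
  rw [← h, quadForm_covMatrix hX]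
  exact integral_nonneg fun ω => sq_nonneg _

theorem ae_inner_eq_zero (hX : MemLp X 2 P) :
    ∀ᵐ ω ∂P, ∀ i, ¬ 0 < (covMatrix_isHermitian P X).eigenvalues i →
      (inner ℝ ((covMatrix_isHermitian P X).eigenvectorBasis i) (X ω - ∫ ω', X ω' ∂P) : ℝ) = 0 := by
  set hA := covMatrix_isHermitian P X
  rw [ae_all_iff]
  intro i
  by_cases hi : 0 < hA.eigenvalues i
  · exact Filter.Eventually.of_forall fun ω h => absurd hi h
  · have h0 : quadForm (covMatrix P X) (hA.eigenvectorBasis i) = 0 := by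
      have h := quadForm_eq_sum_eigenvalues hA (hA.eigenvectorBasis i)
      simp only [hA.eigenvectorBasis.inner_eq_ite] at h
      simp at h
      rw [h]
      exact le_antisymm (not_lt.mp hi) (eigenvalues_covMatrix_nonneg hX i)
    rw [quadForm_covMatrix hX, integral_eq_zero_iff_of_nonneg (fun ω => sq_nonneg _)
      (memLp_inner_centered hX _).integrable_sq] at h0
    filter_upwards [h0] with ω hω _
    exact pow_eq_zero_iff two_ne_zero |>.mp hω

theorem whiten_moments (hX : MemLp X 2 P) {κ : ℝ} (hκ : 1 ≤ κ)
    (hk : kurtosis P X ≤ ENNReal.ofReal κ) :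
    let ρ := P.map fun ω => whiten (covMatrix_isHermitian P X) (∫ ω', X ω' ∂P) (X ω)
    Integrable (fun v => ‖v‖ ^ 4) ρ ∧
    (∀ τ, ‖τ‖ = 1 → ∫ v, (inner ℝ τ v : ℝ) ^ 4 ∂ρ ≤ κ + 2 * √κ + 1) ∧
    (∀ τ, ‖τ‖ = 1 → ∫ v, (inner ℝ τ v : ℝ) ^ 2 ∂ρ ≤ 1) ∧
    ∀ c θ, ∫ v, (inner ℝ (whitenDual (covMatrix_isHermitian P X) c θ) v : ℝ) ^ 2 ∂ρ =
      ‖whitenDual (covMatrix_isHermitian P X) c θ‖ ^ 2 := by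
  intro ρ
  set hA := covMatrix_isHermitian P X
  set m := ∫ ω', X ω' ∂P with hm
  have hVm : AEMeasurable (fun ω => whiten hA m (X ω)) P :=
    (measurable_whiten hA m).comp_aemeasurable hX.aestronglyMeasurable.aemeasurable
  have hq : ∀ θ, 0 ≤ quadForm (covMatrix P X) θ := fun θ => by
    rw [quadForm_covMatrix hX]; exact integral_nonneg fun ω => sq_nonneg _
  refine ⟨?_, fun τ hτ => ?_, fun τ hτ => ?_, fun c θ => ?_⟩
  · rw [integrable_map_measure (by fun_prop) hVm]
    have hi : Integrable (fun ω => ((d : ℝ) + 1) * (1 + ∑ i, invSqrtCoeff hA i ^ 4 *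
        (inner ℝ (hA.eigenvectorBasis i) (X ω - m) : ℝ) ^ 4)) P :=
      ((integrable_const _).add (integrable_finsetSum _ fun i _ =>
        (pow_four_moment_le hX (zero_lt_one.trans_le hκ) hk _).1.const_mul _)).const_mul _
    refine hi.mono' (hVm.norm.pow_const 4).aestronglyMeasurable
      (Filter.Eventually.of_forall fun ω => ?_)
    simp only [Function.comp]
    rw [Real.norm_of_nonneg (by positivity), show (4 : ℕ) = 2 * 2 by norm_num, pow_mul,
      EuclideanSpace.real_norm_sq_eq]
    refine (sq_sum_le_card_mul_sum_sq (s := Finset.univ)).trans (le_of_eq ?_)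
    rw [Fin.sum_univ_succ]
    simp only [whiten, Fin.cons_zero, Fin.cons_succ, Finset.card_univ, Fintype.card_fin]
    push_cast
    congr 2
    · norm_num
    · refine Finset.sum_congr rfl fun i _ => ?_
      ring
  · rw [integral_map hVm (by fun_prop)]
    simp only [inner_whiten]
    refine (affine_moments hX hκ hk _ _).2.trans ?_
    have h := quadForm_whiten_adjoint_le hA τ
    rw [hτ, one_pow] at h
    have h0 := add_nonneg (sq_nonneg (τ 0)) (hq (∑ i, (τ (Fin.succ i) * invSqrtCoeff hA i) •
      hA.eigenvectorBasis i))
    exact mul_le_of_le_one_right (by positivity) (pow_le_one₀ h0 h)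
  · rw [integral_map hVm (by fun_prop)]
    simp only [inner_whiten]
    rw [(affine_moments hX hκ hk _ _).1]
    refine (quadForm_whiten_adjoint_le hA τ).trans ?_
    rw [hτ, one_pow]
  · rw [integral_map hVm (by fun_prop), norm_whitenDual_sq hA (eigenvalues_covMatrix_nonneg hX),
      ← (affine_moments hX hκ hk θ c).1]
    refine integral_congr_ae ?_
    filter_upwards [ae_inner_eq_zero hX] with ω hω
    rw [inner_whitenDual_whiten hA hω]

end CovarianceBounds

/-! ### Quotients with the conventions at zero -/

section Ratio

theorem ratio_of_ne_zero {a b : ℝ} (hb : b ≠ 0) : ratio a b = ((a / b : ℝ) : EReal) := if_neg hb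

theorem ratio_nonneg {a b : ℝ} (ha : 0 ≤ a) (hb : 0 ≤ b) : 0 ≤ ratio a b := by
  unfold ratio
  split_ifs
  · exact zero_le_one
  · exact le_top
  · exact_mod_cast div_nonneg ha hb

theorem ratio_zero_zero_sub_one : ratio 0 0 - 1 = 0 := by
  have : ratio 0 0 = ((1 : ℝ) : EReal) := by simp [ratio]
  rw [this, ← EReal.coe_one, ← EReal.coe_sub]
  simp

theorem ratio_sub_one {a b : ℝ} (hb : b ≠ 0) : ratio a b - 1 = ((a / b - 1 : ℝ) : EReal) := by
  rw [ratio_of_ne_zero hb, ← EReal.coe_one, ← EReal.coe_sub]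

/-- The two-sided bound on a quotient, from the bounds on the quadratic forms. -/
theorem ratio_bounds {a b δ gm gp : ℝ} (hδ : 0 < δ) (hgm : 0 ≤ gm) (hgp : 0 ≤ gp) (hb : 0 ≤ b)
    (h0 : b = 0 → a = 0) (hlow : b * (1 - (δ + gm) / (1 + δ)) ≤ a)
    (hup : 0 < 1 - δ → 0 < 1 - gp → a * ((1 - δ) * (1 - gp)) ≤ b) :
    ((-((δ + gm) / (1 + δ)) : ℝ) : EReal) ≤ ratio a b - 1 ∧
      ratio a b - 1 ≤ ratio (δ + gp) (max (1 - δ) 0 * max (1 - gp) 0) := by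
  rcases hb.eq_or_lt with hb0 | hb0
  · rw [h0 hb0.symm, ← hb0, ratio_zero_zero_sub_one]
    refine ⟨?_, ratio_nonneg (by linarith) (by positivity)⟩
    have : 0 ≤ (δ + gm) / (1 + δ) := by positivity
    exact_mod_cast neg_nonpos.mpr this
  · rw [ratio_sub_one hb0.ne']
    constructor
    · rw [EReal.coe_le_coe_iff]
      have : 1 - (δ + gm) / (1 + δ) ≤ a / b := by
        rw [le_div_iff₀ hb0]; linarith
      linarith
    · by_cases hz : max (1 - δ) 0 * max (1 - gp) 0 = 0
      · rw [hz, ratio, if_pos rfl, if_neg (by linarith : δ + gp ≠ 0)]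
        exact le_top
      · have h1 : 0 < 1 - δ := by
          by_contra h
          exact hz (by rw [max_eq_right (not_lt.mp h), zero_mul])
        have h2 : 0 < 1 - gp := by
          by_contra h
          exact hz (by rw [max_eq_right (not_lt.mp h), mul_zero])
        rw [ratio_of_ne_zero hz, EReal.coe_le_coe_iff, max_eq_left h1.le, max_eq_left h2.le,
          div_sub_one hb0.ne', div_le_div_iff₀ hb0 (by positivity)]
        have := hup h1 h2
        -- `1 - (1 - δ)(1 - γ) = δ + γ - δγ`, and `δγ ≥ 0` is dropped.
        nlinarith [mul_nonneg hδ.le hgp]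

end Ratio

/-! ### Bounds for the empirical covariance, and the theorem -/

section Main

variable {d n : ℕ} {κ ε : ℝ} {Ω₀ : Type*} [MeasurableSpace Ω₀] {P₀ : Measure Ω₀}
  [IsProbabilityMeasure P₀] {X : Ω₀ → Vec d} {Ω : Type*} [MeasurableSpace Ω] {P : Measure Ω}
  {Xs : Fin n → Ω → Vec d}

theorem exists_measurableSet_of_ae {p : Ω → Prop} (h : ∀ᵐ ω ∂P, p ω) :
    ∃ A : Set Ω, MeasurableSet A ∧ P Aᶜ = 0 ∧ ∀ ω ∈ A, p ω := by
  obtain ⟨t, ht, htm, ht0⟩ := exists_measurable_superset_of_null (ae_iff.mp h)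
  refine ⟨tᶜ, htm.compl, by rwa [compl_compl], fun ω hω => ?_⟩
  by_contra hp
  exact hω (ht hp)

theorem ae_inner_sample_eq_zero (hX : MemLp X 2 P₀) (hid : ∀ i, IdentDistrib (Xs i) X P P₀) :
    ∀ᵐ ω ∂P, ∀ i j, ¬ 0 < (covMatrix_isHermitian P₀ X).eigenvalues j →
      (inner ℝ ((covMatrix_isHermitian P₀ X).eigenvectorBasis j)
        (Xs i ω - ∫ ω', X ω' ∂P₀) : ℝ) = 0 := by
  rw [ae_all_iff]
  intro i
  have hm : MeasurableSet {x : Vec d | ∀ j, ¬ 0 < (covMatrix_isHermitian P₀ X).eigenvalues j →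
      (inner ℝ ((covMatrix_isHermitian P₀ X).eigenvectorBasis j)
        (x - ∫ ω', X ω' ∂P₀) : ℝ) = 0} := by
    simp only [Set.ofPred_forall]
    refine MeasurableSet.iInter fun j => MeasurableSet.iInter fun _ => ?_
    exact measurableSet_eq_fun (by fun_prop) measurable_const
  exact (hid i).symm.ae_snd hm (ae_inner_eq_zero hX)

theorem quadForm_covMatrix_nonneg (hX : MemLp X 2 P₀) (θ : Vec d) :
    0 ≤ quadForm (covMatrix P₀ X) θ := by
  rw [quadForm_covMatrix hX]
  exact integral_nonneg fun ω => sq_nonneg _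

variable [IsProbabilityMeasure P]

theorem ofReal_le_measure_of_compl_le {A : Set Ω} (hA : MeasurableSet A) (hε : 0 ≤ ε)
    (h : P Aᶜ ≤ ENNReal.ofReal (2 * ε)) : ENNReal.ofReal (1 - 2 * ε) ≤ P A := by
  rw [ENNReal.ofReal_sub _ (by positivity), ENNReal.ofReal_one]
  have h1 : P A + P Aᶜ = 1 := prob_add_prob_compl hA
  rw [tsub_le_iff_right, ← h1]
  gcongr

/-- Simultaneous bounds on the quadratic forms of the empirical covariance matrix. -/
theorem empCov_bounds (hκ : 1 ≤ κ) (hε : 0 < ε) (hε1 : ε ≤ 1) (hn : sampleBound d κ ε < n)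
    (hX : MemLp X 2 P₀) (hk : kurtosis P₀ X ≤ ENNReal.ofReal κ) (hind : iIndepFun Xs P)
    (hid : ∀ i, IdentDistrib (Xs i) X P P₀) :
    ∃ A : Set Ω, MeasurableSet A ∧ P Aᶜ ≤ ENNReal.ofReal (2 * ε) ∧ ∀ ω ∈ A, ∀ θ : Vec d,
      quadForm (covMatrix P₀ X) θ *
          (1 - (deltaHat d n κ ε + gammaMinus d n κ ε) / (1 + deltaHat d n κ ε)) ≤
        quadForm (empCovMatrix fun i => Xs i ω) θ ∧
      (0 < 1 - deltaHat d n κ ε →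
        0 < 1 - gammaPlus d n κ ε (maxNorm P₀ X fun i => Xs i ω) →
        quadForm (empCovMatrix fun i => Xs i ω) θ * ((1 - deltaHat d n κ ε) *
          (1 - gammaPlus d n κ ε (maxNorm P₀ X fun i => Xs i ω))) ≤
          quadForm (covMatrix P₀ X) θ) := by
  have hn0 := sample_size_pos hn
  have hL0 : 0 ≤ level d ε := le_trans (by positivity) (level_ge (d := d) hε hε1)
  have hδ := deltaHat_pos (zero_lt_one.trans_le hκ) hL0 hn
  set hA := covMatrix_isHermitian P₀ X
  set m := ∫ ω', X ω' ∂P₀ with hm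
  have hev := eigenvalues_covMatrix_nonneg hX
  have hwm := measurable_whiten hA m
  have hXm : AEMeasurable X P₀ := hX.aestronglyMeasurable.aemeasurable
  -- `IdentDistrib` gives only almost everywhere measurability; the deviation bounds need measurable
  -- versions.
  set X' : Fin n → Ω → Vec d := fun i => (hid i).aemeasurable_fst.mk (Xs i)
  have hX'm : ∀ i, Measurable (X' i) := fun i => (hid i).aemeasurable_fst.measurable_mk
  have hX'e : ∀ i, Xs i =ᵐ[P] X' i := fun i => (hid i).aemeasurable_fst.ae_eq_mk
  have hind' : iIndepFun X' P := hind.congr hX'e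
  set ρ := P₀.map fun ω => whiten hA m (X ω)
  have hlaw : ∀ i, P.map (fun ω => whiten hA m (X' i ω)) = ρ := by
    intro i
    have h1 : P.map (X' i) = P₀.map X := by
      rw [← (hid i).map_eq]
      exact (Measure.map_congr (hX'e i)).symm
    have h2 := AEMeasurable.map_map_of_aemeasurable (μ := P₀) (f := X) (g := whiten hA m)
      hwm.aemeasurable hXm
    rw [← h1, Measure.map_map hwm (hX'm i)] at h2
    exact h2
  have : IsProbabilityMeasure ρ :=
    Measure.isProbabilityMeasure_map (hwm.comp_aemeasurable hXm)
  obtain ⟨hint, h4, h2, hdual⟩ := whiten_moments hX hκ hk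
  have hVm : ∀ i, Measurable fun ω => whiten hA m (X' i ω) := fun i => hwm.comp (hX'm i)
  have hVind : iIndepFun (fun i ω => whiten hA m (X' i ω)) P :=
    hind'.comp (fun _ => whiten hA m) fun _ => hwm
  obtain ⟨A₁, hA₁, hP₁, hup⟩ := gram_upper (P := P) (by simp) hVm hVind hlaw hint h4 h2 hκ hε hε1 hn
  obtain ⟨A₂, hA₂, hP₂, hlow⟩ := gram_lower (P := P) (by simp) hVm hVind hlaw hint h4 hκ hε hε1 hn
  obtain ⟨A₀, hA₀, hP₀, h0⟩ := exists_measurableSet_of_ae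
    ((ae_all_iff.mpr hX'e).and (ae_inner_sample_eq_zero hX hid))
  refine ⟨A₁ ∩ A₂ ∩ A₀, (hA₁.inter hA₂).inter hA₀, ?_, fun ω ⟨⟨hω₁, hω₂⟩, hω₀⟩ θ => ?_⟩
  · rw [Set.compl_inter, Set.compl_inter]
    calc P (A₁ᶜ ∪ A₂ᶜ ∪ A₀ᶜ) ≤ P A₁ᶜ + P A₂ᶜ + P A₀ᶜ :=
          (measure_union_le _ _).trans (by gcongr; exact measure_union_le _ _)
      _ ≤ ENNReal.ofReal ε + ENNReal.ofReal ε + 0 := by rw [hP₀]; gcongr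
      _ = _ := by rw [add_zero, ← ENNReal.ofReal_add hε.le hε.le, two_mul]
  obtain ⟨he, hz⟩ := h0 ω hω₀
  have hinner : ∀ i c, (inner ℝ (whitenDual hA c θ) (whiten hA m (X' i ω)) : ℝ) =
      c + inner ℝ θ (Xs i ω - m) := by
    intro i c
    rw [← he i]
    exact inner_whitenDual_whiten hA (hz i) c θ
  constructor
  -- The random constant that performs the empirical centering. It is allowed because the bound is
  -- uniform over `ℝ^(d+1)`.
  · set c : ℝ := -((∑ j, (inner ℝ θ (Xs j ω - m) : ℝ)) / n) with hc
    have h := hlow ω hω₂ (whitenDual hA c θ) (hdual c θ)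
    simp only [hinner, norm_whitenDual_sq hA hev] at h
    have hemp := quadForm_empCovMatrix hn0 (fun i => Xs i ω) m θ
    have e : ∑ i, (c + (inner ℝ θ (Xs i ω - m) : ℝ)) ^ 2 =
        n * quadForm (empCovMatrix fun i => Xs i ω) θ := by
      rw [hemp, hc]
      refine Finset.sum_congr rfl fun i _ => ?_
      ring
    rw [e, mul_assoc] at h
    have h' := le_of_mul_le_mul_left h hn0
    -- Since `γ₋ ≤ 1`, the additional `c²` in `‖whitenDual‖²` only helps and can be discarded.
    have hfac : 0 ≤ 1 - (deltaHat d n κ ε + gammaMinus d n κ ε) / (1 + deltaHat d n κ ε) := by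
      rw [sub_nonneg, div_le_one (by linarith)]
      have := gammaMinus_le_one hκ hε hε1 hn
      linarith
    have : 0 ≤ c ^ 2 * (1 - (deltaHat d n κ ε + gammaMinus d n κ ε) / (1 + deltaHat d n κ ε)) :=
      mul_nonneg (sq_nonneg c) hfac
    linarith
  · intro hδ1 hγ1
    have hR : ∀ i, ‖whiten hA m (X' i ω)‖ ≤ maxNorm P₀ X fun i => Xs i ω := by
      intro i
      have h1 : ‖whiten hA m (X' i ω)‖ =
          √(‖WithLp.toLp 2 ((invSqrt hA).mulVec (Xs i ω - m).ofLp)‖ ^ 2 + 1) := by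
        rw [← he i, ← norm_whiten_sq, Real.sqrt_sq (norm_nonneg _)]
      rw [h1]
      exact le_ciSup (f := fun i =>
        √(‖WithLp.toLp 2 ((invSqrt hA).mulVec (Xs i ω - m).ofLp)‖ ^ 2 + 1))
        (Set.finite_range _).bddAbove i
    -- For the upper bound `c = 0` is enough: empirical centering only decreases the sum of squares.
    have h := hup ω hω₁ (whitenDual hA 0 θ) _ hR hδ1 hγ1
    simp only [hinner, norm_whitenDual_sq hA hev, zero_add] at h
    have hle := quadForm_empCovMatrix_le hn0 (fun i => Xs i ω) m θ
    have h3 := mul_le_mul_of_nonneg_right hle (mul_pos hδ1 hγ1).le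
    have h4 := h3.trans h
    rw [mul_assoc] at h4
    have h5 := le_of_mul_le_mul_left h4 hn0
    simpa using h5

end Main

end EmpCov

theorem mainTheorem12 :
    ∃ C : ℝ, 0 < C ∧ ∀ (d n : ℕ) (κ ε : ℝ), 0 < κ → 0 < ε →
      EmpCov.sampleBound d κ ε < (n : ℝ) →
      -- the orders of magnitude, with a numerical constant
      (1 ≤ d → 1 ≤ κ → ε ≤ 1 →
        EmpCov.deltaHat d n κ ε ≤ C * √(κ * ((d : ℝ) + Real.log ε⁻¹) / n) ∧
        (EmpCov.deltaHat d n κ ε + EmpCov.gammaMinus d n κ ε) / (1 + EmpCov.deltaHat d n κ ε)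
          ≤ C * EmpCov.deltaHat d n κ ε) ∧
      -- the deviation bound
      ∀ (Ω₀ : Type*) [MeasurableSpace Ω₀] (P₀ : Measure Ω₀) [IsProbabilityMeasure P₀]
        (X : Ω₀ → EmpCov.Vec d)
        (Ω : Type*) [MeasurableSpace Ω] (P : Measure Ω) [IsProbabilityMeasure P]
        (Xs : Fin n → Ω → EmpCov.Vec d),
        MemLp X 2 P₀ →
        EmpCov.kurtosis P₀ X ≤ ENNReal.ofReal κ →
        iIndepFun Xs P →
        (∀ i, IdentDistrib (Xs i) X P P₀) →
        ∃ A : Set Ω, MeasurableSet A ∧ ENNReal.ofReal (1 - 2 * ε) ≤ P A ∧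
          ∀ ω ∈ A, ∀ θ : EmpCov.Vec d,
            ((-((EmpCov.deltaHat d n κ ε + EmpCov.gammaMinus d n κ ε) /
                (1 + EmpCov.deltaHat d n κ ε)) : ℝ) : EReal)
              ≤ EmpCov.ratio (EmpCov.quadForm (EmpCov.empCovMatrix fun i => Xs i ω) θ)
                  (EmpCov.quadForm (EmpCov.covMatrix P₀ X) θ) - 1 ∧
            EmpCov.ratio (EmpCov.quadForm (EmpCov.empCovMatrix fun i => Xs i ω) θ)
                (EmpCov.quadForm (EmpCov.covMatrix P₀ X) θ) - 1
              ≤ EmpCov.ratio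
                  (EmpCov.deltaHat d n κ ε +
                    EmpCov.gammaPlus d n κ ε (EmpCov.maxNorm P₀ X fun i => Xs i ω))
                  (max (1 - EmpCov.deltaHat d n κ ε) 0 *
                    max (1 - EmpCov.gammaPlus d n κ ε
                      (EmpCov.maxNorm P₀ X fun i => Xs i ω)) 0) := by
  refine ⟨2000, by norm_num, fun d n κ ε hκ hε hn => ⟨fun hd hκ1 hε1 => ⟨?_, ?_⟩, ?_⟩⟩
  · exact EmpCov.deltaHat_le hd hκ1 hε hε1 hn
  · have hL0 : 0 ≤ EmpCov.level d ε := le_trans (by positivity) (EmpCov.level_ge hε hε1)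
    have := EmpCov.deltaHat_pos hκ hL0 hn
    exact (EmpCov.lower_rate_le hκ1 hε hε1 hn).trans (by linarith)
  intro Ω₀ _ P₀ _ X Ω _ P _ Xs hX hk hind hid
  -- Here `1 - 2ε < 0`, so the empty event works; this also disposes of a negative `L`.
  by_cases hε2 : 1 / 2 < ε
  · refine ⟨∅, MeasurableSet.empty, ?_, fun ω hω => absurd hω (Set.notMem_empty ω)⟩
    rw [ENNReal.ofReal_of_nonpos (by linarith)]
    exact zero_le
  have hε1 : ε ≤ 1 := by linarith
  have hn0 := EmpCov.sample_size_pos hn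
  have hL0 : 0 ≤ EmpCov.level d ε := le_trans (by positivity) (EmpCov.level_ge hε hε1)
  have hδ := EmpCov.deltaHat_pos hκ hL0 hn
  have hγ := EmpCov.gammaMinus_nonneg (n := n) hκ hL0
  have hγ' : ∀ R, 0 ≤ EmpCov.gammaPlus d n κ ε R := fun R => by
    unfold EmpCov.gammaPlus; positivity
  have hcov := EmpCov.quadForm_covMatrix_nonneg hX
  obtain ⟨A₀, hA₀, hP₀, h0⟩ := EmpCov.exists_measurableSet_of_ae
    (EmpCov.ae_inner_sample_eq_zero hX hid)
  have hzero : ∀ ω ∈ A₀, ∀ θ, EmpCov.quadForm (EmpCov.covMatrix P₀ X) θ = 0 →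
      EmpCov.quadForm (EmpCov.empCovMatrix fun i => Xs i ω) θ = 0 := by
    intro ω hω θ hθ
    have hle := EmpCov.quadForm_empCovMatrix_le hn0 (fun i => Xs i ω) (∫ ω', X ω' ∂P₀) θ
    have hz : ∀ i, (inner ℝ θ (Xs i ω - ∫ ω', X ω' ∂P₀) : ℝ) = 0 := fun i =>
      EmpCov.inner_eq_zero_of_quadForm_eq_zero (EmpCov.covMatrix_isHermitian P₀ X)
        (EmpCov.eigenvalues_covMatrix_nonneg hX) (h0 ω hω i) hθ
    simp only [hz] at hle
    have hnn := EmpCov.quadForm_empCovMatrix_nonneg hn0 (fun i => Xs i ω) θ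
    norm_num at hle
    nlinarith
  by_cases hκ1 : 1 ≤ κ
  · obtain ⟨A, hA, hP, hb⟩ := EmpCov.empCov_bounds hκ1 hε hε1 hn hX hk hind hid
    refine ⟨A ∩ A₀, hA.inter hA₀, EmpCov.ofReal_le_measure_of_compl_le (hA.inter hA₀) hε.le ?_,
      fun ω hω θ => EmpCov.ratio_bounds hδ hγ (hγ' _) (hcov θ) (hzero ω hω.2 θ)
        (hb ω hω.1 θ).1 (hb ω hω.1 θ).2⟩
    rw [Set.compl_inter]
    calc P (Aᶜ ∪ A₀ᶜ) ≤ P Aᶜ + P A₀ᶜ := measure_union_le _ _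
      _ ≤ _ := by rw [hP₀, add_zero]; exact hP
  -- A kurtosis bound below `1` forces `Σ = 0`; every quotient is then `0/0 = 1` on `A₀`.
  · have hall : ∀ θ, EmpCov.quadForm (EmpCov.covMatrix P₀ X) θ = 0 := fun θ => by
      by_contra hne
      exact hκ1 (EmpCov.one_le_of_quadForm_pos hX hκ hk (lt_of_le_of_ne (hcov θ) (Ne.symm hne)))
    refine ⟨A₀, hA₀, EmpCov.ofReal_le_measure_of_compl_le hA₀ hε.le (by rw [hP₀]; exact zero_le),
      fun ω hω θ => ?_⟩
    have ha := hzero ω hω θ (hall θ)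
    refine EmpCov.ratio_bounds hδ hγ (hγ' _) (hcov θ) (hzero ω hω θ) ?_ ?_
    · rw [hall θ, ha, zero_mul]
    · intro _ _
      rw [hall θ, ha, zero_mul]
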